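/- Let $p\ge 5$ be a prime, let $R=\widehat{\mathbb Z_p^{\rm ur}}$ (the ring of Witt vectors of an algebraic closure of $\mathbb F_p$), let $K$ be its fraction field and $K^{\rm alg}$ an algebraic closure of $K$, and let $\phi$ be an automorphism of $K^{\rm alg}$ extending the automorphism of $R$ that lifts the $p$-power Frobenius of $R/pR$. Let $\pi\in K^{\rm alg}$ be a root of an Eisenstein polynomial with coefficients in $\mathbb Z_p^{\rm ur}$ such that $\mathbb Q_p(\pi)/\mathbb Q_p$ is Galois; put $K_\pi=K(\pi)$, $R_\pi=R[\pi]$, $e=e(\pi)=[K_\pi:K]$, $\delta_\pi x=(\phi(x)-x^p)/\pi$ on $R_\pi$, $\delta=\delta_p$, and $$\nu:=\left[\frac{\log e}{\log p}\right]+2 .$$ A $\pi$-derivation from an $R_\pi$-algebra $A$ to an $A$-algebra $B$ is a map $\delta_\pi:A\to B$ with $\delta_\pi 1=0$, $\delta_\pi(x+y)=\delta_\pi x+\delta_\pi y+\frac{1}{\pi}(X^p+Y^p-(X+Y)^p)|_{X=x,Y=y}$ and $\delta_\pi(xy)=x^p\delta_\pi y+y^p\delta_\pi x+\pi\,\delta_\pi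 x\,\delta_\pi y$; then $\phi(x)=x^p+\pi\delta_\pi x$ is a ring homomorphism. A $\delta_\pi$-prolongation sequence is a sequence of $R_\pi$-algebras $S^r$, $r\ge 0$, with $R_\pi$-algebra homomorphisms $S^r\to S^{r+1}$ and $\pi$-derivations $\delta_\pi:S^r\to S^{r+1}$ that commute with these homomorphisms and extend $\delta_\pi$ on $R_\pi$. Let ${\bf Prol}_\pi$ be the category of those for which every $S^r$ is Noetherian, $p$-adically complete and flat over $R_\pi$. For an affine scheme $V={\rm Spec}\,A$ of finite type over $R_\pi$, the rings $\mathcal O(J^r_\pi(V))$ form the sequence in ${\bf Prol}_\pi$ with $\mathcal O(J^0_\pi(V))=\widehat A$ (hats denote $p$-adic completion) that is universal among sequences $B^*$ in ${\bf Prol}_\pi$ equipped with an $R_\pi$-algebra homomorphism $A\to B^0$; write $J^r=J^r_p$. Let $X$ be a smooth affine $R$-scheme, $S^r=\mathcal O(J^r(X))$ and $S^r_\pi=\mathcal O(J^r_\pi(X\otimes_R R_\pi))$. The sequence $S^*\otimes_R R_\pi$, with $\phi\otimes\phi$ and $\delta_\pi z=(\phi(z)-z^p)/\pi$, is a $\delta_\pi$-prolongation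 sequence, and universality gives homomorphisms $S^r_\pi\to S^r\otimes_R R_\pi$. Let $\mathcal F$ be a commutative formal group law in $g$ variables over $S^0$ with logarithm $l=(l_k({\bf T}))_{k=1}^g$, $l_k\in(S^0\otimes\mathbb Q)[[{\bf T}]]$, ${\bf T}=(T_1,\dots,T_g)$ (so $l({\bf T})\equiv {\bf T}$ modulo terms of degree $\ge 2$ and $l(\mathcal F({\bf T}_1,{\bf T}_2))=l({\bf T}_1)+l({\bf T}_2)$). For $r\ge0$ put $$L^r_k:=\frac1p\{\phi^r(l_k({\bf T}))\}_{|{\bf T}=0}\in (S^r\otimes\mathbb Q)[[\delta {\bf T},\dots,\delta^r{\bf T}]],$$ where $\delta^i{\bf T}$ are $g$-tuples of new variables and $\phi(\delta^i T_k)=(\delta^iT_k)^p+p\,\delta^{i+1}T_k$. Then the $L^r_k$ belong to $S^r[\delta{\bf T},\dots,\delta^r{\bf T}]^{\widehat{\ }}$; there is a unique natural homomorphism $$S^r_\pi[\delta_\pi{\bf T},\dots,\delta_\pi^r{\bf T}]^{\widehat{\ }}\to S^r[\delta{\bf T},\dots,\delta^r{\bf T}]^{\widehat{\ }}\otimes_R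 R_\pi ,$$ i.e. a unique ring homomorphism that is induced by $S^r_\pi\to S^r\otimes_RR_\pi$ on $S^r_\pi$ and sends $\delta_\pi^iT_k$ to the value at ${\bf T}=0$ of its expression as a polynomial in $T_k,\delta T_k,\dots,\delta^iT_k$ over $R_\pi$; and for all $k=1,\dots,g$ the element $p^\nu L^r_k\otimes 1$ belongs to the image of this homomorphism. -/

import Mathlib

open scoped TensorProduct

universe u

namespace PiJet

/-- The value at `(x, y)` of `C_p(X, Y) = (X ^ p + Y ^ p - (X + Y) ^ p) / p ∈ ℤ[X, Y]`. -/
def cPoly (p : ℕ) {B : Type*} [CommRing B] (x y : B) : B :=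
  -∑ i ∈ Finset.Ico 1 p, ((p.choose i / p : ℕ) : B) * x ^ i * y ^ (p - i)

theorem mul_cPoly (p : ℕ) [hp : Fact p.Prime] {B : Type*} [CommRing B] (x y : B) :
    (p : B) * cPoly p x y = x ^ p + y ^ p - (x + y) ^ p := by
  have h2 := hp.out.two_le
  rw [add_pow, Finset.sum_range_succ, Finset.range_eq_Ico,
    Finset.sum_eq_sum_Ico_succ_bot (by omega : 0 < p), cPoly, mul_neg, Finset.mul_sum]
  have : ∀ i ∈ Finset.Ico 1 p, (p : B) * (((p.choose i / p : ℕ) : B) * x ^ i * y ^ (p - i)) =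
      x ^ i * y ^ (p - i) * (p.choose i : B) := by
    intro i hi
    rw [Finset.mem_Ico] at hi
    have hd : p ∣ p.choose i := hp.out.dvd_choose_self (by omega) (by omega)
    have : (p : B) * ((p.choose i / p : ℕ) : B) = (p.choose i : B) := by
      rw [← Nat.cast_mul, Nat.mul_div_cancel' hd]
    rw [← this]; ring
  rw [Finset.sum_congr rfl this]
  simp
  ring

section Base

variable (p : ℕ) [Fact p.Prime]

/-- `R`, the completion of the ring of integers of `ℚ_p^ur`, realised as the ring of Witt vectors
of an algebraic closure of `𝔽_p`. -/
abbrev R : Type := WittVector p (AlgebraicClosure (ZMod p))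

/-- The fraction field of `R`, i.e. the completion of `ℚ_p^ur`. -/
abbrev K : Type := FractionRing (R p)

/-- An algebraic closure of `K`. -/
abbrev Kalg : Type := AlgebraicClosure (K p)

/-- `ℤ_p = W(𝔽_p) ⊆ R`. -/
noncomputable instance : Algebra ℤ_[p] (R p) :=
  ((WittVector.map (algebraMap (ZMod p) (AlgebraicClosure (ZMod p)))).comp
    (WittVector.fromPadicInt p)).toAlgebra

theorem algebraMap_padicInt_injective : Function.Injective (algebraMap ℤ_[p] (K p)) := by
  rw [IsScalarTower.algebraMap_eq ℤ_[p] (R p) (K p)]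
  refine (IsFractionRing.injective (R p) (K p)).comp ?_
  refine (WittVector.map_injective _ (FaithfulSMul.algebraMap_injective _ _)).comp ?_
  exact Function.LeftInverse.injective (g := WittVector.toPadicInt p)
    (WittVector.toPadicInt_comp_fromPadicInt_ext p)

/-- `ℚ_p ⊆ K`. -/
noncomputable instance : Algebra ℚ_[p] (K p) :=
  (IsFractionRing.lift (algebraMap_padicInt_injective p)).toAlgebra

instance : IsScalarTower ℤ_[p] ℚ_[p] (K p) :=
  IsScalarTower.of_algebraMap_eq fun x =>
    (IsFractionRing.lift_algebraMap (algebraMap_padicInt_injective p) x).symm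

variable {p}

/-- Membership in the set `Π` of all `π` in the algebraic closure of `ℚ_p` inside `Kalg` that are roots of an
Eisenstein polynomial over `ℤ_p^ur` (the elements of `R` that are integral over `ℤ_p`)
and for which `ℚ_p(π) / ℚ_p` is Galois. -/
def IsPi (π : Kalg p) : Prop :=
  (∃ f : Polynomial (R p), f.Monic ∧ f.IsEisensteinAt (Ideal.span {(p : R p)}) ∧
    (∀ n, IsIntegral ℤ_[p] (f.coeff n)) ∧ Polynomial.aeval π f = 0) ∧
  IsGalois ℚ_[p] (IntermediateField.adjoin ℚ_[p] {π})

/-- `φ` extends the automorphism of `R` that lifts the Frobenius of the residue field. -/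
def ExtendsFrobenius (φ : Kalg p ≃+* Kalg p) : Prop :=
  ∀ x : R p, φ (algebraMap (R p) (Kalg p) x) =
    algebraMap (R p) (Kalg p) (WittVector.frobenius x)

/-- `R_π = R[π]`. -/
noncomputable abbrev Rpi (π : Kalg p) : Subalgebra (R p) (Kalg p) := Algebra.adjoin (R p) {π}

/-- `e(π) = [K(π) : K]`. -/
noncomputable def ramIndex (π : Kalg p) : ℕ :=
  Module.finrank (K p) (IntermediateField.adjoin (K p) {π})

theorem dvd_frobenius_sub (x : R p) : (p : R p) ∣ WittVector.frobenius x - x ^ p := by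
  rw [← Ideal.mem_span_singleton, WittVector.mem_span_p_iff_coeff_zero_eq_zero]
  have h : WittVector.constantCoeff (WittVector.frobenius x - x ^ p) = 0 := by
    rw [map_sub, map_pow]
    change (WittVector.frobenius x).coeff 0 - x.coeff 0 ^ p = 0
    rw [WittVector.coeff_frobenius_charP, sub_self]
  exact h

theorem phi_padic {φ : Kalg p ≃+* Kalg p} (hφ : ExtendsFrobenius φ) (x : ℚ_[p]) :
    φ (algebraMap ℚ_[p] (Kalg p) x) = algebraMap ℚ_[p] (Kalg p) x := by
  have h : (φ : Kalg p →+* Kalg p).comp (algebraMap ℚ_[p] (Kalg p)) =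
      algebraMap ℚ_[p] (Kalg p) := by
    apply IsLocalization.ringHom_ext (nonZeroDivisors ℤ_[p])
    ext z
    have e : algebraMap ℚ_[p] (Kalg p) (algebraMap ℤ_[p] ℚ_[p] z) =
        algebraMap (R p) (Kalg p) (algebraMap ℤ_[p] (R p) z) := by
      rw [IsScalarTower.algebraMap_apply ℚ_[p] (K p) (Kalg p),
        ← IsScalarTower.algebraMap_apply ℤ_[p] ℚ_[p] (K p),
        IsScalarTower.algebraMap_apply ℤ_[p] (R p) (K p),
        ← IsScalarTower.algebraMap_apply (R p) (K p) (Kalg p)]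
    simp only [RingHom.comp_apply, RingHom.coe_coe]
    rw [e, hφ]
    congr 1
    ext n
    rw [WittVector.coeff_frobenius_charP]
    change (WittVector.map _ _).coeff n ^ p = (WittVector.map _ _).coeff n
    rw [WittVector.map_coeff, ← map_pow, ZMod.pow_card]
  exact congrArg (fun f => f x) h

theorem phi_pi_mem_adjoin {φ : Kalg p ≃+* Kalg p} (hφ : ExtendsFrobenius φ) {π : Kalg p}
    (hπ : IsPi π) : φ π ∈ IntermediateField.adjoin ℚ_[p] {π} := by
  have := hπ.2
  let σ : Kalg p →ₐ[ℚ_[p]] Kalg p :=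
    { (φ : Kalg p →+* Kalg p) with commutes' := phi_padic hφ }
  have hn : Normal ℚ_[p] (IntermediateField.adjoin ℚ_[p] {π}) := inferInstance
  set x : IntermediateField.adjoin ℚ_[p] {π} :=
    ⟨π, IntermediateField.mem_adjoin_simple_self _ _⟩ with hx
  have hint : IsIntegral ℚ_[p] x := hn.isIntegral x
  have hs := hn.splits x
  rw [IntermediateField.splits_iff_mem (L := Kalg p) (IsAlgClosed.splits _)] at hs
  refine hs _ ?_
  rw [Polynomial.mem_rootSet]
  refine ⟨minpoly.ne_zero hint, ?_⟩
  have h0 : Polynomial.aeval π (minpoly ℚ_[p] x) = 0 := by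
    have := congrArg (algebraMap (IntermediateField.adjoin ℚ_[p] {π}) (Kalg p))
      (minpoly.aeval ℚ_[p] x)
    rwa [map_zero, ← Polynomial.aeval_algebraMap_apply] at this
  have h1 := Polynomial.aeval_algHom_apply σ π (minpoly ℚ_[p] x)
  rw [h0, map_zero] at h1
  exact h1

theorem algebraMap_R_injective : Function.Injective (algebraMap (R p) (Kalg p)) := by
  rw [IsScalarTower.algebraMap_eq (R p) (K p) (Kalg p)]
  exact (algebraMap (K p) (Kalg p)).injective.comp (IsFractionRing.injective (R p) (K p))

instance : Module.IsTorsionFree (R p) (Kalg p) :=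
  Module.isTorsionFree_iff_algebraMap_injective.2 algebraMap_R_injective

theorem minpoly_eq {π : Kalg p} {f : Polynomial (R p)} (hm : f.Monic)
    (he : f.IsEisensteinAt (Ideal.span {(p : R p)})) (h0 : Polynomial.aeval π f = 0) :
    minpoly (R p) π = f := by
  have hint : IsIntegral (R p) π := ⟨f, hm, h0⟩
  have hp : Prime (p : R p) := (WittVector.irreducible p).prime
  have hd : 0 < f.natDegree := by
    rw [Nat.pos_iff_ne_zero]
    intro h
    rw [Polynomial.Monic.natDegree_eq_zero hm] at h
    simp [h] at h0
  have hirr := he.irreducible ((Ideal.span_singleton_prime hp.ne_zero).2 hp) hm.isPrimitive hd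
  obtain ⟨q, hq⟩ := minpoly.isIntegrallyClosed_dvd hint h0
  have hu := (hirr.isUnit_or_isUnit hq).resolve_left (minpoly.not_isUnit (R p) π)
  exact Polynomial.eq_of_monic_of_associated (minpoly.monic hint) hm
    ⟨hu.unit, hq.symm⟩

theorem mem_Rpi_of_isIntegral {π : Kalg p} (hπ : IsPi π) {z : Kalg p}
    (hz : z ∈ IntermediateField.adjoin (K p) {π}) (hi : IsIntegral (R p) z) : z ∈ Rpi π := by
  obtain ⟨⟨f, hm, he, -, h0⟩, -⟩ := hπ
  have hint : IsIntegral (R p) π := ⟨f, hm, h0⟩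
  have hintK : IsIntegral (K p) π := hint.tower_top
  have hp : Prime (p : R p) := (WittVector.irreducible p).prime
  set L := IntermediateField.adjoin (K p) {π} with hL
  have : IsScalarTower (R p) L (Kalg p) := IsScalarTower.of_algebraMap_eq fun _ => rfl
  let B : PowerBasis (K p) L := IntermediateField.adjoin.powerBasis hintK
  have hgen : algebraMap L (Kalg p) B.gen = π := by
    simp [B, IntermediateField.adjoin.powerBasis_gen]
  have hinj : Function.Injective (algebraMap L (Kalg p)) := (algebraMap L (Kalg p)).injective
  have hBint : IsIntegral (R p) B.gen := by
    rw [← isIntegral_algebraMap_iff (B := Kalg p) hinj, hgen]; exact hint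
  have hmin : (minpoly (R p) B.gen).IsEisensteinAt (Ideal.span {(p : R p)}) := by
    rw [← minpoly.algebraMap_eq (B' := Kalg p) hinj, hgen, minpoly_eq hm he h0]; exact he
  let z' : L := ⟨z, hz⟩
  have hz'int : IsIntegral (R p) z' := by
    rw [← isIntegral_algebraMap_iff (B := Kalg p) hinj]; exact hi
  have key : ∃ n : ℕ, (p : R p) ^ n • z' ∈ Algebra.adjoin (R p) ({B.gen} : Set L) := by
    obtain ⟨q, hq⟩ : ∃ q : Polynomial (K p), z' = Polynomial.aeval B.gen q :=
      B.exists_eq_aeval' z'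
    obtain ⟨b, hb0, hb⟩ := IsLocalization.integerNormalization_spec
      (nonZeroDivisors (R p)) q
    obtain ⟨n, c, hc⟩ := WittVector.exists_eq_pow_p_mul' b (nonZeroDivisors.ne_zero hb0)
    refine ⟨n, ?_⟩
    have h1 : b • z' = Polynomial.aeval B.gen
        (IsLocalization.integerNormalization (nonZeroDivisors (R p)) q) := by
      rw [← Polynomial.aeval_map_algebraMap (K p), hb, hq, ← algebraMap_smul (K p) b q, map_smul,
        algebraMap_smul]
    have h2 : (p : R p) ^ n • z' = ((c⁻¹ : (R p)ˣ) : R p) • (b • z') := by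
      rw [smul_smul, hc, mul_comm, mul_assoc, Units.mul_inv, mul_one]
    rw [h2, h1]
    exact Subalgebra.smul_mem _ (Polynomial.aeval_mem_adjoin_singleton _ _) _
  obtain ⟨n, hn⟩ := key
  have := mem_adjoin_of_smul_prime_pow_smul_of_minpoly_isEisensteinAt hp hBint hz'int hn hmin
  have h2 := (Subalgebra.mem_map (f := IsScalarTower.toAlgHom (R p) L (Kalg p))).2
    ⟨z', this, rfl⟩
  rw [AlgHom.map_adjoin] at h2
  simpa [hgen] using h2

theorem isIntegral_pi {π : Kalg p} (hπ : IsPi π) : IsIntegral (R p) π := by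
  obtain ⟨⟨f, hm, -, -, h0⟩, -⟩ := hπ
  exact ⟨f, hm, h0⟩

theorem phi_pi_mem {φ : Kalg p ≃+* Kalg p} (hφ : ExtendsFrobenius φ) {π : Kalg p}
    (hπ : IsPi π) : φ π ∈ Rpi π := by
  refine mem_Rpi_of_isIntegral hπ ?_ ?_
  · have h : IntermediateField.adjoin ℚ_[p] {π} ≤
        (IntermediateField.adjoin (K p) {π}).restrictScalars ℚ_[p] := by
      rw [IntermediateField.adjoin_le_iff, Set.singleton_subset_iff]
      exact IntermediateField.mem_adjoin_simple_self (K p) π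
    exact h (phi_pi_mem_adjoin hφ hπ)
  · obtain ⟨⟨f, hm, -, -, h0⟩, -⟩ := hπ
    refine ⟨f.map WittVector.frobenius, hm.map _, ?_⟩
    rw [Polynomial.eval₂_map]
    have : (algebraMap (R p) (Kalg p)).comp WittVector.frobenius =
        (φ : Kalg p →+* Kalg p).comp (algebraMap (R p) (Kalg p)) := by
      ext x; exact (hφ x).symm
    rw [this, ← RingHom.coe_coe φ, ← Polynomial.hom_eval₂, ← Polynomial.aeval_def, h0, map_zero]

theorem phi_mem {φ : Kalg p ≃+* Kalg p} (hφ : ExtendsFrobenius φ) {π : Kalg p}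
    (hπ : IsPi π) {x : Kalg p} (hx : x ∈ Rpi π) : φ x ∈ Rpi π := by
  induction hx using Algebra.adjoin_induction with
  | mem x hx => rw [Set.mem_singleton_iff.1 hx]; exact phi_pi_mem hφ hπ
  | algebraMap r => rw [hφ]; exact Subalgebra.algebraMap_mem _ _
  | add x y _ _ h1 h2 => rw [map_add]; exact add_mem h1 h2
  | mul x y _ _ h1 h2 => rw [map_mul]; exact mul_mem h1 h2

/-- The restriction of `φ` to `R_π`. -/
noncomputable def phiPi {φ : Kalg p ≃+* Kalg p} (hφ : ExtendsFrobenius φ) {π : Kalg p}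
    (hπ : IsPi π) : Rpi π →+* Rpi π :=
  ((φ : Kalg p →+* Kalg p).comp (Rpi π).val.toRingHom).codRestrict (Rpi π)
    fun x => phi_mem hφ hπ x.2

/-- `π` as an element of `R_π`. -/
noncomputable def piElt (π : Kalg p) : Rpi π := ⟨π, Algebra.self_mem_adjoin_singleton _ _⟩

theorem exists_add_pi_mul {π : Kalg p} (x : Rpi π) :
    ∃ (a : R p) (y : Rpi π), x = algebraMap (R p) (Rpi π) a + piElt π * y := by
  obtain ⟨x, hx⟩ := x
  have hx' : x ∈ Algebra.adjoin (R p) {π} := hx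
  rw [Algebra.adjoin_singleton_eq_range_aeval] at hx'
  obtain ⟨q, rfl⟩ := hx'
  refine ⟨q.coeff 0, ⟨Polynomial.aeval π q.divX, Polynomial.aeval_mem_adjoin_singleton _ _⟩, ?_⟩
  apply Subtype.ext
  change Polynomial.aeval π q = algebraMap (R p) (Kalg p) (q.coeff 0) +
    π * Polynomial.aeval π q.divX
  conv_lhs => rw [← Polynomial.divX_mul_X_add q]
  simp only [map_add, map_mul, Polynomial.aeval_X, Polynomial.aeval_C]
  ring

theorem isUnit_or_dvd (a : R p) : IsUnit a ∨ (p : R p) ∣ a := by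
  by_cases h : a.coeff 0 = 0
  · right; rwa [← Ideal.mem_span_singleton, WittVector.mem_span_p_iff_coeff_zero_eq_zero]
  · left; exact WittVector.isUnit_of_coeff_zero_ne_zero a h

theorem exists_pi_mul {π : Kalg p} (hπ : IsPi π) : ∃ c : Rpi π, piElt π * c = p := by
  obtain ⟨⟨f, hm, he, -, h0⟩, -⟩ := hπ
  have hp : Prime (p : R p) := (WittVector.irreducible p).prime
  have hd : f.natDegree ≠ 0 := by
    intro h
    rw [Polynomial.Monic.natDegree_eq_zero hm] at h
    simp [h] at h0
  obtain ⟨d, hd'⟩ := Ideal.mem_span_singleton.1 (he.coeff_mem (n := 0) hd.symm)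
  have hu : IsUnit d := by
    refine (isUnit_or_dvd d).resolve_right fun ⟨w, hw⟩ => he.notMem ?_
    rw [Ideal.span_singleton_pow, Ideal.mem_span_singleton]
    exact ⟨w, by rw [hd', hw]; ring⟩
  obtain ⟨v, rfl⟩ := hu
  refine ⟨-(algebraMap (R p) (Rpi π) (v⁻¹ : (R p)ˣ)) *
    ⟨Polynomial.aeval π f.divX, Polynomial.aeval_mem_adjoin_singleton _ _⟩, ?_⟩
  apply Subtype.ext
  change π * (-(algebraMap (R p) (Kalg p) (v⁻¹ : (R p)ˣ)) * Polynomial.aeval π f.divX) = _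
  have h1 : Polynomial.aeval π f.divX * π + algebraMap (R p) (Kalg p) (p * v) = 0 := by
    rw [← h0, ← hd']
    conv_rhs => rw [← Polynomial.divX_mul_X_add f]
    simp
  have h2 : π * Polynomial.aeval π f.divX = - algebraMap (R p) (Kalg p) (p * v) := by
    rw [mul_comm]; exact eq_neg_of_add_eq_zero_left h1
  calc _ = - algebraMap (R p) (Kalg p) (v⁻¹ : (R p)ˣ) * (π * Polynomial.aeval π f.divX) := by ring
    _ = algebraMap (R p) (Kalg p) (p * (v * (v⁻¹ : (R p)ˣ))) := by
      rw [h2]; simp only [map_mul]; ring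
    _ = _ := by rw [Units.mul_inv, mul_one, map_natCast]; rfl

theorem exists_pi_pow {π : Kalg p} (hπ : IsPi π) :
    ∃ (n : ℕ) (w : Rpi π), piElt π ^ n = p * w := by
  obtain ⟨⟨f, hm, he, -, h0⟩, -⟩ := hπ
  have h := he.isWeaklyEisensteinAt.exists_mem_adjoin_mul_eq_pow_natDegree h0 hm
  obtain ⟨y, hy, h⟩ := h
  refine ⟨(f.map (algebraMap (R p) (Kalg p))).natDegree, ⟨y, hy⟩, Subtype.ext ?_⟩
  change π ^ _ = ((p : Rpi π) : Kalg p) * y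
  rw [← h, map_natCast]; rfl

theorem not_isUnit_pi {π : Kalg p} (hπ : IsPi π) : ¬ IsUnit (piElt π) := by
  intro hu
  obtain ⟨n, w, h⟩ := exists_pi_pow hπ
  have h1 : IsUnit (algebraMap (R p) (Rpi π) p) := by
    rw [map_natCast]; exact isUnit_of_mul_isUnit_left (h ▸ hu.pow n)
  have hint : (algebraMap (R p) (Rpi π)).IsIntegral :=
    (Algebra.IsIntegral.adjoin (fun x hx => by
      rw [Set.mem_singleton_iff.1 hx]; exact isIntegral_pi hπ)).isIntegral
  have := hint.isLocalHom (fun x y hxy => algebraMap_R_injective (congrArg Subtype.val hxy))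
  exact (WittVector.irreducible (k := AlgebraicClosure (ZMod p)) p).not_isUnit
    (isUnit_of_map_unit _ _ h1)

theorem pi_dvd_phi_sub {φ : Kalg p ≃+* Kalg p} (hφ : ExtendsFrobenius φ) {π : Kalg p}
    (hπ : IsPi π) (x : Rpi π) : piElt π ∣ phiPi hφ hπ x - x ^ p := by
  have hp0 : p ≠ 0 := (Fact.out : p.Prime).ne_zero
  have hpp : piElt π ∣ (p : Rpi π) := by
    obtain ⟨c, hc⟩ := exists_pi_mul hπ; exact ⟨c, hc.symm⟩
  have hR (a : R p) : phiPi hφ hπ (algebraMap (R p) (Rpi π) a) =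
      algebraMap (R p) (Rpi π) (WittVector.frobenius a) := Subtype.ext (hφ a)
  have hbase : piElt π ∣ phiPi hφ hπ (piElt π) := by
    obtain ⟨a, y, h⟩ := exists_add_pi_mul (phiPi hφ hπ (piElt π))
    have ha : ¬ IsUnit a := by
      intro hu
      obtain ⟨n, w, hw⟩ := exists_pi_pow hπ
      have h1 : piElt π ∣ (phiPi hφ hπ (piElt π)) ^ n := by
        rw [← map_pow, hw, map_mul, map_natCast]; exact hpp.mul_right _
      have h2 : piElt π ∣ (phiPi hφ hπ (piElt π)) ^ n - algebraMap (R p) (Rpi π) a ^ n :=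
        (show piElt π ∣ phiPi hφ hπ (piElt π) - algebraMap (R p) (Rpi π) a from
          ⟨y, by rw [h]; ring⟩).trans (sub_dvd_pow_sub_pow _ _ n)
      have h3 := (dvd_sub_right h1).1 h2
      exact not_isUnit_pi hπ (isUnit_of_dvd_unit h3 ((hu.map _).pow n))
    obtain ⟨b, rfl⟩ := (isUnit_or_dvd a).resolve_left ha
    rw [h, map_mul, map_natCast]
    exact dvd_add (hpp.mul_right _) (dvd_mul_right _ _)
  have key : ∀ a y : Rpi π, piElt π ∣ phiPi hφ hπ a - a ^ p →
      piElt π ∣ phiPi hφ hπ (a + piElt π * y) - (a + piElt π * y) ^ p := by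
    intro a y ha
    have e : phiPi hφ hπ (a + piElt π * y) - (a + piElt π * y) ^ p =
        (phiPi hφ hπ a - a ^ p) + phiPi hφ hπ (piElt π) * phiPi hφ hπ y
          - (piElt π * y) ^ p + p * cPoly p a (piElt π * y) := by
      rw [mul_cPoly, map_add, map_mul]; ring
    rw [e]
    refine dvd_add (dvd_sub (dvd_add ha (hbase.mul_right _)) ?_) (hpp.mul_right _)
    exact (dvd_mul_right _ _).trans (dvd_pow_self _ hp0)
  obtain ⟨a, y, rfl⟩ := exists_add_pi_mul x
  refine key _ _ ?_
  rw [hR, ← map_pow, ← map_sub]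
  obtain ⟨b, hb⟩ := dvd_frobenius_sub a
  rw [hb, map_mul, map_natCast]
  exact hpp.mul_right _

end Base

/-- A ring `O` with a uniformizing element `ϖ` dividing `p` (with quotient `quo = p / ϖ`), an
endomorphism `φ` lifting the `p`-power map modulo `ϖ`, and the Fermat quotient operator
`δ x = (φ x - x ^ p) / ϖ`. -/
structure FrobeniusBase (p : ℕ) (O : Type*) [CommRing O] where
  ϖ : O
  quo : O
  φ : O →+* O
  δ : O → O
  ϖ_mul_quo : ϖ * quo = p
  φ_eq : ∀ x, φ x = x ^ p + ϖ * δ x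

/-- The ring `R` with `ϖ = p`, its Frobenius, and `δ = δ_p`. -/
noncomputable def baseR (p : ℕ) [Fact p.Prime] : FrobeniusBase p (R p) where
  ϖ := p
  quo := 1
  φ := WittVector.frobenius
  δ x := (dvd_frobenius_sub x).choose
  ϖ_mul_quo := mul_one _
  φ_eq x := by rw [← (dvd_frobenius_sub x).choose_spec]; ring

/-- The ring `R_π` with `ϖ = π`, the restriction of `φ`, and `δ = δ_π`. -/
noncomputable def baseRpi {p : ℕ} [Fact p.Prime] {φ : Kalg p ≃+* Kalg p} (hφ : ExtendsFrobenius φ) {π : Kalg p}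
    (hπ : IsPi π) : FrobeniusBase p (Rpi π) where
  ϖ := piElt π
  quo := (exists_pi_mul hπ).choose
  φ := phiPi hφ hπ
  δ x := (pi_dvd_phi_sub hφ hπ x).choose
  ϖ_mul_quo := (exists_pi_mul hπ).choose_spec
  φ_eq x := by rw [← (pi_dvd_phi_sub hφ hπ x).choose_spec]; ring



section Prolongation

variable {p : ℕ} {O : Type} [CommRing O]

/-- `δ` is a `π`-derivation along `f`; the polynomial `C_π` is `(p / π) C_p`. -/
structure IsPiDerivation (F : FrobeniusBase p O) {A B : Type*} [CommRing A] [CommRing B]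
    [Algebra O A] [Algebra O B] (f : A →ₐ[O] B) (δ : A → B) : Prop where
  map_one : δ 1 = 0
  map_add : ∀ x y, δ (x + y) = δ x + δ y + algebraMap O B F.quo * cPoly p (f x) (f y)
  map_mul : ∀ x y, δ (x * y) =
    f x ^ p * δ y + f y ^ p * δ x + algebraMap O B F.ϖ * δ x * δ y

/-- A prolongation sequence over the base `O`: algebras `S^r`, algebra maps `S^r → S^{r+1}`, and
`π`-derivations `S^r → S^{r+1}` compatible with them and with `δ` on `O`. -/
structure ProlSeq (F : FrobeniusBase p O) where
  obj : ℕ → Type u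
  [ring : ∀ r, CommRing (obj r)]
  [alg : ∀ r, Algebra O (obj r)]
  incl : ∀ r, obj r →ₐ[O] obj (r + 1)
  δ : ∀ r, obj r → obj (r + 1)
  isPiDerivation : ∀ r, IsPiDerivation F (incl r) (δ r)
  δ_incl : ∀ r x, δ (r + 1) (incl r x) = incl (r + 1) (δ r x)
  δ_base : ∀ r x, δ r (algebraMap O (obj r) x) = algebraMap O (obj (r + 1)) (F.δ x)

namespace ProlSeq

attribute [instance] ProlSeq.ring ProlSeq.alg

variable {F : FrobeniusBase p O}

/-- Morphisms of prolongation sequences over `O`. -/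
structure Hom (S S' : ProlSeq.{u} F) where
  map : ∀ r, S.obj r →ₐ[O] S'.obj r
  map_incl : ∀ r x, map (r + 1) (S.incl r x) = S'.incl r (map r x)
  map_δ : ∀ r x, map (r + 1) (S.δ r x) = S'.δ r (map r x)

/-- The category `Prol`: every `S^r` is Noetherian, `p`-adically complete and flat over `O`. -/
structure InProl (S : ProlSeq.{u} F) : Prop where
  noetherian : ∀ r, IsNoetherianRing (S.obj r)
  complete : ∀ r, IsAdicComplete (Ideal.span {(p : S.obj r)}) (S.obj r)
  flat : ∀ r, Module.Flat O (S.obj r)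

/-- `S`, together with `ι : A → S^0`, is the sequence `(𝒪(J^r(Spec A)))_r` of rings of functions on
the jet spaces of `Spec A` over `O`: it lies in `Prol`, `ι` exhibits `S^0` as the `p`-adic
completion of `A`, and it is universal among the prolongation sequences in `Prol`
whose `0`-th ring receives a homomorphism from `A`. -/
structure IsJet {A : Type u} [CommRing A] [Algebra O A] (S : ProlSeq.{u} F)
    (ι : A →ₐ[O] S.obj 0) : Prop where
  inProl : S.InProl
  completion_injective : ∀ (n : ℕ) (a : A), (p : S.obj 0) ^ n ∣ ι a → (p : A) ^ n ∣ a
  completion_surjective : ∀ (n : ℕ) (s : S.obj 0), ∃ a : A, (p : S.obj 0) ^ n ∣ s - ι a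
  universal : ∀ (B : ProlSeq.{u} F), B.InProl → ∀ v : A →ₐ[O] B.obj 0,
    ∃! w : Hom S B, ∀ a, w.map 0 (ι a) = v a

variable [Fact p.Prime]

/-- The ring homomorphism `φ(x) = x ^ p + π δ x`. -/
def phi (S : ProlSeq.{u} F) (r : ℕ) : S.obj r →+* S.obj (r + 1) where
  toFun x := S.incl r x ^ p + algebraMap O _ F.ϖ * S.δ r x
  map_one' := by simp [(S.isPiDerivation r).map_one]
  map_mul' x y := by rw [(S.isPiDerivation r).map_mul, map_mul]; ring
  map_zero' := by
    have h := (S.isPiDerivation r).map_add 0 0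
    have hc : cPoly p (S.incl r 0) (S.incl r 0) = 0 := by
      rw [cPoly, neg_eq_zero]
      refine Finset.sum_eq_zero fun i hi => ?_
      rw [Finset.mem_Ico] at hi
      rw [map_zero, zero_pow (by omega : i ≠ 0), mul_zero, zero_mul]
    rw [hc, add_zero, mul_zero, add_zero] at h
    have h' : S.δ r 0 = 0 := by simpa using h
    rw [h', map_zero, mul_zero, add_zero, zero_pow (Fact.out : p.Prime).ne_zero]
  map_add' x y := by
    have h : algebraMap O (S.obj (r + 1)) F.ϖ * algebraMap O (S.obj (r + 1)) F.quo = p := by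
      rw [← map_mul, F.ϖ_mul_quo, map_natCast]
    have h2 := mul_cPoly p (S.incl r x) (S.incl r y)
    rw [(S.isPiDerivation r).map_add, map_add]
    linear_combination h2 + cPoly p (S.incl r x) (S.incl r y) * h

/-- The `r`-fold iterate `φ^r : S^0 → S^r`. -/
def phiIter (S : ProlSeq.{u} F) : ∀ r, S.obj 0 →+* S.obj r
  | 0 => RingHom.id _
  | r + 1 => (S.phi r).comp (phiIter S r)

theorem phi_base (S : ProlSeq.{u} F) (r : ℕ) (x : O) :
    S.phi r (algebraMap O _ x) = algebraMap O _ (F.φ x) := by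
  change S.incl r _ ^ p + _ * S.δ r _ = _
  rw [S.δ_base, F.φ_eq, AlgHom.commutes]
  simp

end ProlSeq

/-- Compatibility of the data on `O'` with those on `O`: `O'` extends `O` together with `φ`, and
`ϖ'` is a non-zero-divisor dividing `ϖ`. -/
structure FrobeniusBase.Extends (F : FrobeniusBase p O) {O' : Type} [CommRing O'] [Algebra O O']
    (F' : FrobeniusBase p O') : Prop where
  φ_algebraMap : ∀ x, F'.φ (algebraMap O O' x) = algebraMap O O' (F.φ x)
  ϖ_mem : F'.ϖ ∈ nonZeroDivisors O'
  ϖ_dvd : F'.ϖ ∣ algebraMap O O' F.ϖ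

namespace ProlSeq

variable [Fact p.Prime] {F : FrobeniusBase p O} {O' : Type} [CommRing O'] [Algebra O O']
  {F' : FrobeniusBase p O'}

/-- The ring homomorphism `φ ⊗ φ : O' ⊗ S^r → O' ⊗ S^{r+1}`. -/
noncomputable def baseChangePhi (S : ProlSeq.{u} F) (h : F.Extends F') (r : ℕ) :
    O' ⊗[O] S.obj r →+* O' ⊗[O] S.obj (r + 1) :=
  let f : O' ⊗[O] S.obj r →+ O' ⊗[O] S.obj (r + 1) :=
    TensorProduct.liftAddHom
      { toFun := fun y =>
          { toFun := fun x => F'.φ y ⊗ₜ[O] S.phi r x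
            map_zero' := by simp
            map_add' := fun x x' => by rw [map_add, TensorProduct.tmul_add] }
        map_zero' := by ext; simp
        map_add' := fun y y' => by ext x; simp [TensorProduct.add_tmul] }
      fun c y x => by
        simp only [AddMonoidHom.coe_mk, ZeroHom.coe_mk, Algebra.smul_def, map_mul,
          h.φ_algebraMap, phi_base]
        rw [← Algebra.smul_def, ← Algebra.smul_def, TensorProduct.smul_tmul]
  { f with
    map_one' := by
      change F'.φ 1 ⊗ₜ[O] S.phi r 1 = 1
      rw [map_one, map_one]; rfl
    map_mul' := fun z w => by
      change f (z * w) = f z * f w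
      induction z with
      | zero => simp
      | add a b ha hb => rw [add_mul, map_add, map_add, ha, hb, add_mul]
      | tmul y x =>
        induction w with
        | zero => simp
        | add a b ha hb => rw [mul_add, map_add, map_add, ha, hb, mul_add]
        | tmul y' x' =>
          rw [Algebra.TensorProduct.tmul_mul_tmul]
          change F'.φ (y * y') ⊗ₜ[O] S.phi r (x * x') =
            (F'.φ y ⊗ₜ[O] S.phi r x) * (F'.φ y' ⊗ₜ[O] S.phi r x')
          rw [Algebra.TensorProduct.tmul_mul_tmul, map_mul, map_mul] }

theorem baseChangePhi_tmul (S : ProlSeq.{u} F) (h : F.Extends F') (r : ℕ) (y : O')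
    (x : S.obj r) : S.baseChangePhi h r (y ⊗ₜ x) = F'.φ y ⊗ₜ S.phi r x := rfl

/-- The map `S^r → S^{r+1}` after base change. -/
noncomputable abbrev baseChangeIncl (S : ProlSeq.{u} F) (O' : Type) [CommRing O'] [Algebra O O']
    (r : ℕ) : O' ⊗[O] S.obj r →ₐ[O'] O' ⊗[O] S.obj (r + 1) :=
  Algebra.TensorProduct.map (AlgHom.id O' O') (S.incl r)

theorem baseChange_dvd (S : ProlSeq.{u} F) (h : F.Extends F') (r : ℕ) (z : O' ⊗[O] S.obj r) :
    algebraMap O' _ F'.ϖ ∣ S.baseChangePhi h r z - S.baseChangeIncl O' r z ^ p := by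
  have hp0 : p ≠ 0 := (Fact.out : p.Prime).ne_zero
  induction z with
  | zero => simp [hp0]
  | add a b ha hb =>
    have e : S.baseChangePhi h r (a + b) - S.baseChangeIncl O' r (a + b) ^ p =
        (S.baseChangePhi h r a - S.baseChangeIncl O' r a ^ p) +
        (S.baseChangePhi h r b - S.baseChangeIncl O' r b ^ p) +
        p * cPoly p (S.baseChangeIncl O' r a) (S.baseChangeIncl O' r b) := by
      rw [mul_cPoly, map_add, map_add]; ring
    rw [e]
    refine dvd_add (dvd_add ha hb) (Dvd.dvd.mul_right ?_ _)
    exact ⟨algebraMap O' _ F'.quo, by rw [← map_mul, F'.ϖ_mul_quo, map_natCast]⟩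
  | tmul y x =>
    obtain ⟨d, hd⟩ := h.ϖ_dvd
    have e : S.baseChangePhi h r (y ⊗ₜ x) - S.baseChangeIncl O' r (y ⊗ₜ x) ^ p =
        algebraMap O' _ F'.ϖ * (F'.δ y ⊗ₜ S.phi r x + (y ^ p * d) ⊗ₜ S.δ r x) := by
      rw [baseChangePhi_tmul, Algebra.TensorProduct.map_tmul, Algebra.TensorProduct.tmul_pow,
        AlgHom.id_apply, ← Algebra.smul_def, smul_add, TensorProduct.smul_tmul',
        TensorProduct.smul_tmul', smul_eq_mul, smul_eq_mul]
      have e1 : F'.φ y = y ^ p + F'.ϖ * F'.δ y := F'.φ_eq y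
      have e2 : S.phi r x = S.incl r x ^ p + algebraMap O _ F.ϖ * S.δ r x := rfl
      have e3 : (F'.ϖ * (y ^ p * d)) ⊗ₜ[O] S.δ r x =
          (y ^ p) ⊗ₜ[O] (algebraMap O _ F.ϖ * S.δ r x) := by
        rw [← Algebra.smul_def F.ϖ (S.δ r x), ← TensorProduct.smul_tmul,
          Algebra.smul_def F.ϖ (y ^ p), hd]
        congr 1; ring
      rw [e1, TensorProduct.add_tmul, e3]
      nth_rw 1 [e2]
      rw [TensorProduct.tmul_add]
      abel
    exact ⟨_, e⟩

set_option linter.unusedSectionVars false in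
theorem baseChange_cancel (S : ProlSeq.{u} F) (h : F.Extends F') (r : ℕ)
    (hS : Module.Flat O (S.obj r)) {a b : O' ⊗[O] S.obj r}
    (hab : algebraMap O' _ F'.ϖ * a = algebraMap O' _ F'.ϖ * b) : a = b := by
  have : Module.Flat O' (O' ⊗[O] S.obj r) := inferInstance
  refine Module.Flat.isSMulRegular_of_nonZeroDivisors (M := O' ⊗[O] S.obj r) h.ϖ_mem ?_
  simpa only [Algebra.smul_def] using hab

/-- The prolongation sequence `S^* ⊗ O'` over `O'`, for `S^*` flat over `O`: the operator is
`δ z = (φ z - z ^ p) / ϖ'` with `φ = φ ⊗ φ`. -/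
noncomputable def baseChange (S : ProlSeq.{u} F) (h : F.Extends F')
    (hS : ∀ r, Module.Flat O (S.obj r)) : ProlSeq.{u} F' where
  obj r := O' ⊗[O] S.obj r
  incl r := S.baseChangeIncl O' r
  δ r z := (S.baseChange_dvd h r z).choose
  isPiDerivation r := by
    have H (z) := (S.baseChange_dvd h r z).choose_spec
    refine ⟨?_, fun x y => ?_, fun x y => ?_⟩ <;>
      refine S.baseChange_cancel h (r + 1) (hS _) ?_
    · rw [← H]; simp
    · have hq : algebraMap O' (O' ⊗[O] S.obj (r + 1)) F'.ϖ * algebraMap O' _ F'.quo = p := by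
        rw [← map_mul, F'.ϖ_mul_quo, map_natCast]
      have h2 := mul_cPoly p (S.baseChangeIncl O' r x) (S.baseChangeIncl O' r y)
      have H1 := H x
      have H2 := H y
      rw [← H, map_add, map_add]
      linear_combination H1 + H2 - h2 -
        cPoly p (S.baseChangeIncl O' r x) (S.baseChangeIncl O' r y) * hq
    · have H1 := H x
      have H2 := H y
      rw [← H, map_mul, map_mul]
      linear_combination S.baseChangePhi h r y * H1 + (S.baseChangeIncl O' r x ^ p +
        algebraMap O' _ F'.ϖ * (S.baseChange_dvd h r x).choose) * H2
  δ_incl r x := by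
    refine S.baseChange_cancel h (r + 2) (hS _) ?_
    rw [← (S.baseChange_dvd h (r + 1) _).choose_spec]
    have H := congrArg (S.baseChangeIncl O' (r + 1)) (S.baseChange_dvd h r x).choose_spec
    rw [map_mul, AlgHom.commutes] at H
    rw [← H, map_sub, map_pow]
    congr 1
    clear H
    induction x with
    | zero => simp
    | add a b ha hb => simp only [map_add, ha, hb]
    | tmul y x =>
      simp only [Algebra.TensorProduct.map_tmul, baseChangePhi_tmul, AlgHom.id_apply]
      congr 1
      change S.incl (r + 1) _ ^ p + algebraMap O _ F.ϖ * S.δ (r + 1) _ =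
        S.incl (r + 1) (S.incl r x ^ p + algebraMap O _ F.ϖ * S.δ r x)
      rw [S.δ_incl, map_add, map_mul, map_pow, AlgHom.commutes]
  δ_base r x := by
    refine S.baseChange_cancel h (r + 1) (hS _) ?_
    rw [← (S.baseChange_dvd h r _).choose_spec, AlgHom.commutes,
      Algebra.TensorProduct.algebraMap_apply, baseChangePhi_tmul, map_one]
    have : F'.φ x ⊗ₜ[O] (1 : S.obj (r + 1)) =
      algebraMap O' (O' ⊗[O] S.obj (r + 1)) (F'.φ x) := rfl
    rw [Algebra.algebraMap_self, RingHom.id_apply, this, F'.φ_eq, map_add, map_mul, map_pow]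
    simp

end ProlSeq
end Prolongation

theorem baseR_extends {p : ℕ} [Fact p.Prime] {φ : Kalg p ≃+* Kalg p} (hφ : ExtendsFrobenius φ)
    {π : Kalg p} (hπ : IsPi π) : (baseR p).Extends (baseRpi hφ hπ) where
  φ_algebraMap a := Subtype.ext (hφ a)
  ϖ_mem := by
    refine mem_nonZeroDivisors_of_ne_zero fun h0 => ?_
    obtain ⟨c, hc⟩ := exists_pi_mul hπ
    change piElt π = 0 at h0
    rw [h0, zero_mul] at hc
    have h1 : algebraMap (R p) (Kalg p) p = algebraMap (R p) (Kalg p) 0 := by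
      rw [map_zero, map_natCast]
      exact (congrArg Subtype.val hc).symm
    exact (WittVector.irreducible (k := AlgebraicClosure (ZMod p)) p).ne_zero
      (algebraMap_R_injective h1)
  ϖ_dvd := by
    obtain ⟨c, hc⟩ := exists_pi_mul hπ
    exact ⟨c, by change algebraMap _ _ (p : R p) = piElt π * c; rw [hc, map_natCast]⟩

section FormalGroups

open MvPowerSeries in
/-- A commutative formal group law in `g` variables over `B`. -/
structure FormalGroupLaw (g : ℕ) (B : Type*) [CommRing B] where
  series : Fin g → MvPowerSeries (Fin g ⊕ Fin g) B
  add_zero : ∀ k, subst (Sum.elim X fun _ => 0 : Fin g ⊕ Fin g → MvPowerSeries (Fin g) B)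
    (series k) = X k
  zero_add : ∀ k, subst (Sum.elim (fun _ => 0) X : Fin g ⊕ Fin g → MvPowerSeries (Fin g) B)
    (series k) = X k
  assoc : ∀ k,
    subst (Sum.elim
      (fun i => subst (Sum.elim (fun j => X (Sum.inl j)) (fun j => X (Sum.inr (Sum.inl j))))
        (series i))
      (fun i => X (Sum.inr (Sum.inr i))) :
        Fin g ⊕ Fin g → MvPowerSeries (Fin g ⊕ Fin g ⊕ Fin g) B) (series k) =
    subst (Sum.elim
      (fun i => X (Sum.inl i))
      (fun i => subst (Sum.elim (fun j => X (Sum.inr (Sum.inl j)))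
        (fun j => X (Sum.inr (Sum.inr j)))) (series i)) :
        Fin g ⊕ Fin g → MvPowerSeries (Fin g ⊕ Fin g ⊕ Fin g) B) (series k)
  comm : ∀ k, subst (Sum.elim (fun j => X (Sum.inr j)) (fun j => X (Sum.inl j)) :
    Fin g ⊕ Fin g → MvPowerSeries (Fin g ⊕ Fin g) B) (series k) = series k

open MvPowerSeries in
/-- `l` is the logarithm of `𝓕`: the (unique) `g`-tuple of series over `B ⊗ ℚ` with
`l(T) ≡ T` modulo terms of degree `≥ 2` and `l(𝓕(T₁, T₂)) = l(T₁) + l(T₂)`. -/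
structure FormalGroupLaw.IsLogarithm {g : ℕ} {B : Type*} [CommRing B] (𝓕 : FormalGroupLaw g B)
    (l : Fin g → MvPowerSeries (Fin g) (ℚ ⊗[ℤ] B)) : Prop where
  constantCoeff_eq : ∀ k, constantCoeff (l k) = 0
  linear_eq : ∀ k j, coeff (Finsupp.single j 1) (l k) = if j = k then 1 else 0
  map_add : ∀ k,
    subst (fun i => MvPowerSeries.map
      (Algebra.TensorProduct.includeRight : B →ₐ[ℤ] ℚ ⊗[ℤ] B).toRingHom (𝓕.series i)) (l k) =
    subst (fun i => (X (Sum.inl i) : MvPowerSeries (Fin g ⊕ Fin g) (ℚ ⊗[ℤ] B))) (l k) +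
    subst (fun i => (X (Sum.inr i) : MvPowerSeries (Fin g ⊕ Fin g) (ℚ ⊗[ℤ] B))) (l k)

end FormalGroups

section Jets

/-- On polynomials in variables `(j, k)`, standing for `δ^j T_k`: the homomorphism `φ` that is `θ`
on coefficients and satisfies `φ(δ^j T_k) = (δ^j T_k) ^ p + p δ^{j+1} T_k`. -/
noncomputable def phiPoly (p g : ℕ) {O : Type*} [CommRing O] (θ : O →+* O) :
    MvPolynomial (ℕ × Fin g) O →+* MvPolynomial (ℕ × Fin g) O :=
  MvPolynomial.eval₂Hom (MvPolynomial.C.comp θ)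
    fun jk => MvPolynomial.X jk ^ p + (p : MvPolynomial (ℕ × Fin g) O) *
      MvPolynomial.X (jk.1 + 1, jk.2)

theorem phiPoly_dvd {p : ℕ} [Fact p.Prime] (g : ℕ) {O : Type*} [CommRing O]
    (F : FrobeniusBase p O) (z : MvPolynomial (ℕ × Fin g) O) :
    MvPolynomial.C F.ϖ ∣ phiPoly p g F.φ z - z ^ p := by
  have hpp : MvPolynomial.C F.ϖ ∣ (p : MvPolynomial (ℕ × Fin g) O) :=
    ⟨MvPolynomial.C F.quo, by rw [← map_mul, F.ϖ_mul_quo, map_natCast]⟩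
  induction z using MvPolynomial.induction_on with
  | C a =>
    refine ⟨MvPolynomial.C (F.δ a), ?_⟩
    simp [phiPoly, F.φ_eq]
  | add a b ha hb =>
    have e : phiPoly p g F.φ (a + b) - (a + b) ^ p = (phiPoly p g F.φ a - a ^ p) +
        (phiPoly p g F.φ b - b ^ p) + p * cPoly p a b := by
      rw [mul_cPoly, map_add]; ring
    rw [e]
    exact dvd_add (dvd_add ha hb) (hpp.mul_right _)
  | mul_X a n ha =>
    have e : phiPoly p g F.φ (a * MvPolynomial.X n) - (a * MvPolynomial.X n) ^ p =
        (phiPoly p g F.φ a - a ^ p) * MvPolynomial.X n ^ p +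
          (p : MvPolynomial (ℕ × Fin g) O) * (phiPoly p g F.φ a * MvPolynomial.X (n.1 + 1, n.2)) := by
      have hX : phiPoly p g F.φ (MvPolynomial.X n) = MvPolynomial.X n ^ p +
          (p : MvPolynomial (ℕ × Fin g) O) * MvPolynomial.X (n.1 + 1, n.2) := by
        simp only [phiPoly, MvPolynomial.coe_eval₂Hom, MvPolynomial.eval₂_X]
      rw [map_mul, hX]
      ring
    rw [e]
    exact dvd_add (ha.mul_right _) (hpp.mul_right _)

/-- `δ_π^i T_k` as a polynomial over `R_π` in the `δ^j T_k`:
`δ_π^{i+1} T_k = (φ(δ_π^i T_k) - (δ_π^i T_k) ^ p) / π`. -/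
noncomputable def deltaPoly {p : ℕ} [Fact p.Prime] (g : ℕ) {O : Type*} [CommRing O]
    (F : FrobeniusBase p O) : ℕ → Fin g → MvPolynomial (ℕ × Fin g) O
  | 0, k => MvPolynomial.X (0, k)
  | i + 1, k => (phiPoly_dvd g F (deltaPoly g F i k)).choose

/-- The substitution `T = 0`: the pair `(j, k)`, standing for `δ^j T_k`, goes to `0` for `j = 0`
and to the variable `(j - 1, k)` for `1 ≤ j ≤ r`. The variable `(i, k) : Fin r × Fin g`
thus stands for `δ^{i+1} T_k`. (The value at `j > r` is never used.) -/
noncomputable def atZero (r g : ℕ) (B : Type*) [CommRing B] (jk : ℕ × Fin g) :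
    MvPolynomial (Fin r × Fin g) B :=
  if h : 1 ≤ jk.1 ∧ jk.1 ≤ r then MvPolynomial.X (⟨jk.1 - 1, by omega⟩, jk.2) else 0

/-- The `p`-adic completion `B[δT, …, δ^r T]^`. -/
abbrev JetRing (p r g : ℕ) (B : Type*) [CommRing B] : Type _ :=
  AdicCompletion (Ideal.span {(p : MvPolynomial (Fin r × Fin g) B)})
    (MvPolynomial (Fin r × Fin g) B)

/-- The canonical homomorphism `B[δT, …, δ^r T] → B[δT, …, δ^r T]^`. -/
noncomputable def toJetRing (p r g : ℕ) (B : Type*) [CommRing B] :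
    MvPolynomial (Fin r × Fin g) B →+* JetRing p r g B :=
  algebraMap _ _

/-- The element `x` of `B[δT, …, δ^r T]^` has the expansion `f ∈ (B ⊗ ℚ)[[δT, …, δ^r T]]`: for
every `n` both agree modulo `p ^ n` with one and the same polynomial over `B`. -/
def HasExpansion {p r g : ℕ} {B : Type*} [CommRing B] (x : JetRing p r g B)
    (f : MvPowerSeries (Fin r × Fin g) (ℚ ⊗[ℤ] B)) : Prop :=
  ∀ n : ℕ, ∃ P : MvPolynomial (Fin r × Fin g) B,
    AdicCompletion.evalₐ _ n x = Ideal.Quotient.mk _ P ∧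
    ∀ β, ∃ b : B, MvPowerSeries.coeff β f = 1 ⊗ₜ[ℤ] (MvPolynomial.coeff β P + (p : B) ^ n * b)

/-- `L^r_k = (1 / p) {φ^r(l_k(T))}|_{T = 0} ∈ (S^r ⊗ ℚ)[[δT, …, δ^r T]]`: apply `φ^r` to the
coefficients of `l_k` and substitute `φ^r(T)|_{T = 0}` for `T`. -/
noncomputable def jetLog {p : ℕ} [Fact p.Prime] {O : Type} [CommRing O] {F : FrobeniusBase p O}
    (S : ProlSeq.{u} F) {g : ℕ} (l : Fin g → MvPowerSeries (Fin g) (ℚ ⊗[ℤ] S.obj 0)) (r : ℕ)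
    (k : Fin g) : MvPowerSeries (Fin r × Fin g) (ℚ ⊗[ℤ] S.obj r) :=
  (p : ℚ)⁻¹ • MvPowerSeries.subst
    (fun i => ((MvPolynomial.aeval (atZero r g (ℚ ⊗[ℤ] S.obj r))
      ((phiPoly p g (RingHom.id ℤ))^[r] (MvPolynomial.X (0, i))) :
        MvPolynomial (Fin r × Fin g) (ℚ ⊗[ℤ] S.obj r)) :
          MvPowerSeries (Fin r × Fin g) (ℚ ⊗[ℤ] S.obj r)))
    (MvPowerSeries.map
      (Algebra.TensorProduct.map (AlgHom.id ℤ ℚ) (S.phiIter r).toIntAlgHom).toRingHom (l k))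

variable {p : ℕ} [Fact p.Prime] {O : Type} [CommRing O] {F : FrobeniusBase p O}
  {O' : Type} [CommRing O'] [Algebra O O'] {F' : FrobeniusBase p O'}

/-- `Ψ` is the natural homomorphism
`S_π^r[δ_π T, …, δ_π^r T]^ → R_π ⊗ S^r[δT, …, δ^r T]^`. On `S_π^r` it is the `r`-th
component of the morphism of prolongation sequences `S_π^* → R_π ⊗ S^*` that extends `ι`,
and it sends `δ_π^i T_k` to the value at `T = 0` of its expression through `T, δT, …, δ^i T`. -/
def IsNaturalMap {A : Type u} [CommRing A] [Algebra O A] (S : ProlSeq.{u} F)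
    (ι : A →ₐ[O] S.obj 0) (h : F.Extends F') (hS : ∀ r, Module.Flat O (S.obj r))
    (Sπ : ProlSeq.{u} F') (ιπ : O' ⊗[O] A →ₐ[O'] Sπ.obj 0) (r g : ℕ)
    (Ψ : JetRing p r g (Sπ.obj r) →+* O' ⊗[O] JetRing p r g (S.obj r)) : Prop :=
  ∃ v : ProlSeq.Hom Sπ (S.baseChange h hS),
    (∀ x, v.map 0 (ιπ x) = Algebra.TensorProduct.map (AlgHom.id O' O') ι x) ∧
    (∀ b, Ψ (toJetRing p r g _ (MvPolynomial.C b)) =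
      Algebra.TensorProduct.map (AlgHom.id O' O')
        (IsScalarTower.toAlgHom O (S.obj r) (JetRing p r g (S.obj r))) (v.map r b)) ∧
    ∀ (i : Fin r) (k : Fin g), Ψ (toJetRing p r g _ (MvPolynomial.X (i, k))) =
      MvPolynomial.aeval (fun jk => 1 ⊗ₜ[O] toJetRing p r g (S.obj r) (atZero r g _ jk))
        (deltaPoly g F' (i + 1) k)

end Jets

end PiJet

open PiJet

/-! ### Chain rule for substitution of power series. -/

namespace MvPowerSeries

variable {σ τ R : Type*} [CommRing R]

/-! The proof bounds the denominators of the logarithm and plays them off against powers of `p`,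
respectively of `π`, produced by setting `T = 0`.

Differentiating `l(F(X, Y)) = l(X) + l(Y)` in `Y` at `Y = 0` shows that the Jacobian of `l` is
inverse to the matrix `(∂F_i/∂Y_j)(X, 0)`, which is invertible over `S^0`. So the derivatives of `l`
are integral (`IsLogarithm.exists_pderiv_eq`). Since `S^0` is `p`-adically complete, integers prime
to `p` are units there, and the coefficient of `l_k` at `T^α` has the form `b / p^m` with `p^m ≤
|α|` (`IsLogarithm.exists_pow_mul_coeff`).

Over `R`, `φ^r(T_i)|_{T=0} = p P_i`, so the `α`-term of `L^r_k` is `p^(|α|-1-m) φ^r(b) P^α`. It is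
integral because `m < p^m ≤ |α|`, and it tends to zero; the sum of these terms is the element `L k`
of the completed polynomial ring.

Over `R_π`, the same element `φ^r(T_i)|_{T=0}` equals `π Ψ(Q_i)` with `Q_i` a polynomial in the
`δ_π^j T` (`exists_jetPoly_eq`). Hence `p^(N+1)` times the `α`-term is `p^(N-m) π^|α| φ^r(b)
Ψ(Q)^α`. With `e` the ramification index, `π^n` is divisible by `p^(n/e)` (floor division). With `s
= ⌊log e / log p⌋` one has `e < p^(s+1)`, and `p^m ≤ n` then implies `m ≤ s + 1 + n/e`
(`le_add_div_of_pow_le`). So `N = s + 1` makes all these scalars integral, which explains `ν = s +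
2`; they also tend to zero. The coefficients `φ^r(b)` come from `S_π^r`, because `S_π^0 → R_π ⊗ S^0`
is surjective and the morphism of prolongation sequences commutes with `φ`. Summing the lifted terms
gives a preimage (`mem_range_of_terms`).

Existence and uniqueness of `Ψ` combine the universality of `S_π^*`, applied to `R_π ⊗ S^*`, with
the universal property of completed polynomial rings. Both need `R_π ⊗ B` to inherit completeness
from `B`, which holds because `R_π` is finite free over `R`. -/

theorem constantCoeff_subst_of_constantCoeff_zero [Finite σ] {a : σ → MvPowerSeries τ R}
    (ha : ∀ i, constantCoeff (a i) = 0) (f : MvPowerSeries σ R) :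
    constantCoeff (subst a f) = constantCoeff f := by
  have hs := hasSubst_of_constantCoeff_zero ha
  have h := constantCoeff_subst_eq_zero hs ha (f := f - C (constantCoeff f)) (by simp)
  rw [subst_sub hs, subst_C, map_sub, constantCoeff_C, sub_eq_zero] at h
  exact h

theorem coeff_subst_eq_zero_of_degree_lt_order {a : σ → MvPowerSeries τ R} (hs : HasSubst a)
    (ha : ∀ i, constantCoeff (a i) = 0) {f : MvPowerSeries σ R} {d : τ →₀ ℕ}
    (h : (d.degree : ℕ∞) < f.order) : coeff d (subst a f) = 0 := by
  refine coeff_of_lt_order (h.trans_le (le_trans ?_ (le_order_subst hs f)))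
  have h1 : (1 : ℕ∞) ≤ ⨅ i, (a i).order :=
    le_iInf fun i => one_le_order_iff_constCoeff_eq_zero.2 (ha i)
  calc f.order = 1 * f.order := (one_mul _).symm
    _ ≤ _ := by gcongr

theorem pderiv_subst_coe [Fintype σ] {a : σ → MvPowerSeries τ R} (hs : HasSubst a) (j : τ)
    (q : MvPolynomial σ R) :
    pderiv R j (subst a (q : MvPowerSeries σ R)) =
      ∑ i, subst a (pderiv R i (q : MvPowerSeries σ R)) * pderiv R j (a i) := by
  classical
  induction q using MvPolynomial.induction_on with
  | C r =>
    have h0 : subst a (0 : MvPowerSeries σ R) = 0 := by rw [← coe_substAlgHom hs, map_zero]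
    simp only [MvPolynomial.coe_C, subst_C, pderiv_C, h0, zero_mul, Finset.sum_const_zero]
  | add q q' h h' =>
    simp only [MvPolynomial.coe_add, subst_add hs, map_add, h, h', add_mul, Finset.sum_add_distrib]
  | mul_X q n h =>
    simp only [MvPolynomial.coe_mul, MvPolynomial.coe_X, subst_mul hs, subst_X hs,
      Derivation.leibniz, subst_add hs, smul_eq_mul, h, add_mul, Finset.sum_add_distrib,
      Finset.mul_sum]
    congr 1
    · rw [Finset.sum_eq_single n]
      · rw [pderiv_X_self, ← coe_substAlgHom hs, map_one, mul_one]
      · intro i _ hi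
        rw [pderiv_X_of_ne hi.symm, ← coe_substAlgHom hs, map_zero, mul_zero, zero_mul]
      · simp
    · exact Finset.sum_congr rfl fun i _ => by ring

theorem lt_order_of_coeff {f : MvPowerSeries σ R} {n : ℕ}
    (h : ∀ d : σ →₀ ℕ, d.degree ≤ n → coeff d f = 0) : (n : ℕ∞) < f.order := by
  have : ((n + 1 : ℕ) : ℕ∞) ≤ f.order := nat_le_order fun d hd => h d (by omega)
  exact lt_of_lt_of_le (by exact_mod_cast Nat.lt_succ_self n) this

/-- The chain rule for substitution of power series without constant term. -/
theorem pderiv_subst [Fintype σ] {a : σ → MvPowerSeries τ R}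
    (ha : ∀ i, constantCoeff (a i) = 0) (j : τ) (f : MvPowerSeries σ R) :
    pderiv R j (subst a f) = ∑ i, subst a (pderiv R i f) * pderiv R j (a i) := by
  classical
  have hs := hasSubst_of_constantCoeff_zero ha
  ext d
  -- Differentiation lowers the degree by one, so the coefficient at `d` only sees terms of `f` of
  -- degree at most `|d| + 1`. This reduces the claim to polynomials.
  set q := truncTotal (d.degree + 2) f
  have hfq (e : σ →₀ ℕ) (he : e.degree ≤ d.degree + 1) :
      coeff e (f - (q : MvPowerSeries σ R)) = 0 := by
    rw [map_sub, MvPolynomial.coeff_coe, coeff_truncTotal _ (by omega), sub_self]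
  have h1 : coeff d (pderiv R j (subst a (f - (q : MvPowerSeries σ R)))) = 0 := by
    rw [coeff_pderiv, coeff_subst_eq_zero_of_degree_lt_order hs ha, zero_mul]
    refine lt_order_of_coeff fun e he => hfq e ?_
    simpa [Finsupp.degree_single] using he
  have h2 (i : σ) :
      coeff d (subst a (pderiv R i (f - (q : MvPowerSeries σ R))) * pderiv R j (a i)) = 0 := by
    rw [coeff_mul]
    refine Finset.sum_eq_zero fun x hx => ?_
    rw [coeff_subst_eq_zero_of_degree_lt_order hs ha, zero_mul]
    refine lt_order_of_coeff fun e he => ?_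
    rw [coeff_pderiv, hfq, zero_mul]
    rw [map_add, Finsupp.degree_single]
    have := congrArg Finsupp.degree (Finset.HasAntidiagonal.mem_antidiagonal.1 hx)
    rw [map_add] at this
    omega
  have e : f = (f - (q : MvPowerSeries σ R)) + q := by ring
  have h3 := pderiv_subst_coe hs j q
  rw [e, subst_add hs, map_add, map_add, h1, h3]
  simp only [map_add, subst_add hs, add_mul, Finset.sum_add_distrib]
  rw [map_sum (coeff d) (fun i => subst a (pderiv R i (f - (q : MvPowerSeries σ R))) *
    pderiv R j (a i)), Finset.sum_eq_zero fun i _ => h2 i]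

theorem map_pderiv {S : Type*} [CommRing S] (θ : R →+* S) (i : σ) (f : MvPowerSeries σ R) :
    map θ (pderiv R i f) = pderiv S i (map θ f) := by
  ext d
  simp [coeff_pderiv]

end MvPowerSeries

/-! ### Integrality of the derivatives of the logarithm. -/

namespace PiJet.FormalGroupLaw

open MvPowerSeries

variable {g : ℕ} {B : Type*} [CommRing B]

theorem constantCoeff_elim_X_zero (i : Fin g ⊕ Fin g) :
    constantCoeff ((Sum.elim X fun _ => 0 : Fin g ⊕ Fin g → MvPowerSeries (Fin g) B) i) = 0 := by
  cases i <;> simp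

theorem constantCoeff_elim_zero_X (i : Fin g ⊕ Fin g) :
    constantCoeff ((Sum.elim (fun _ => 0) X : Fin g ⊕ Fin g → MvPowerSeries (Fin g) B) i) = 0 := by
  cases i <;> simp

theorem constantCoeff_series (𝓕 : FormalGroupLaw g B) (k : Fin g) :
    constantCoeff (𝓕.series k) = 0 := by
  rw [← constantCoeff_subst_of_constantCoeff_zero constantCoeff_elim_X_zero, 𝓕.add_zero,
    constantCoeff_X]

/-- The matrix `(∂F_i / ∂Y_j)(X, 0)` of a formal group law `F(X, Y)`. -/
noncomputable def derivMatrix (𝓕 : FormalGroupLaw g B) :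
    Matrix (Fin g) (Fin g) (MvPowerSeries (Fin g) B) :=
  fun i j => subst (Sum.elim X fun _ => 0 : Fin g ⊕ Fin g → MvPowerSeries (Fin g) B)
    (pderiv B (Sum.inr j) (𝓕.series i))

/-- The value at the origin is the same whether reached through `Y = 0` or through `X = 0`, and
along `X = 0` it is found by differentiating `F(0, Y) = Y`. -/
theorem constantCoeff_derivMatrix (𝓕 : FormalGroupLaw g B) (i j : Fin g) :
    constantCoeff (𝓕.derivMatrix i j) = (1 : Matrix (Fin g) (Fin g) B) i j := by
  classical
  rw [derivMatrix, constantCoeff_subst_of_constantCoeff_zero constantCoeff_elim_X_zero,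
    ← constantCoeff_subst_of_constantCoeff_zero constantCoeff_elim_zero_X]
  have h := congrArg (pderiv B j) (𝓕.zero_add i)
  rw [pderiv_subst constantCoeff_elim_zero_X, Fintype.sum_sum_type] at h
  simp only [Sum.elim_inl, Sum.elim_inr, map_zero, mul_zero, Finset.sum_const_zero,
    _root_.zero_add] at h
  rw [Finset.sum_eq_single j, pderiv_X_self, mul_one] at h
  · rw [h, pderiv_X, Matrix.one_apply, Pi.single_apply]
    split_ifs <;> simp
  · intro b _ hb; rw [pderiv_X_of_ne hb, mul_zero]
  · simp

theorem isUnit_det_derivMatrix (𝓕 : FormalGroupLaw g B) : IsUnit 𝓕.derivMatrix.det := by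
  rw [isUnit_iff_constantCoeff, RingHom.map_det]
  have : (constantCoeff (R := B)).mapMatrix 𝓕.derivMatrix = 1 := by
    ext i j; exact 𝓕.constantCoeff_derivMatrix i j
  rw [this, Matrix.det_one]
  exact isUnit_one

/-- Apply `∂/∂Y_j` to `l(F(X, Y)) = l(X) + l(Y)` and put `Y = 0`. The chain rule gives the left
side; on the right only `(∂l_k/∂T_j)(0)` survives, known from the linear part of `l`. -/
theorem IsLogarithm.sum_pderiv_mul {𝓕 : FormalGroupLaw g B}
    {l : Fin g → MvPowerSeries (Fin g) (ℚ ⊗[ℤ] B)} (hl : 𝓕.IsLogarithm l) (k j : Fin g) :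
    ∑ i, pderiv _ i (l k) * MvPowerSeries.map
      (Algebra.TensorProduct.includeRight : B →ₐ[ℤ] ℚ ⊗[ℤ] B).toRingHom (𝓕.derivMatrix i j) =
      if k = j then 1 else 0 := by
  classical
  set θ := (Algebra.TensorProduct.includeRight : B →ₐ[ℤ] ℚ ⊗[ℤ] B).toRingHom
  have hF (i : Fin g) : constantCoeff (MvPowerSeries.map θ (𝓕.series i)) = 0 := by
    rw [constantCoeff_map, constantCoeff_series, map_zero]
  have hs := hasSubst_of_constantCoeff_zero
    (constantCoeff_elim_X_zero (g := g) (B := ℚ ⊗[ℤ] B))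
  have hsB := hasSubst_of_constantCoeff_zero (constantCoeff_elim_X_zero (g := g) (B := B))
  have hθ : (fun i => MvPowerSeries.map θ
      ((Sum.elim X fun _ => 0 : Fin g ⊕ Fin g → MvPowerSeries (Fin g) B) i)) =
      (Sum.elim X fun _ => 0 : Fin g ⊕ Fin g → MvPowerSeries (Fin g) (ℚ ⊗[ℤ] B)) := by
    ext1 i; cases i <;> simp
  have h := congrArg (fun f => subst
    (Sum.elim X fun _ => 0 : Fin g ⊕ Fin g → MvPowerSeries (Fin g) (ℚ ⊗[ℤ] B))
    (pderiv _ (Sum.inr j) f)) (hl.map_add k)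
  simp only [_root_.map_add] at h
  rw [pderiv_subst hF, pderiv_subst (fun _ => constantCoeff_X _),
    pderiv_subst (fun _ => constantCoeff_X _)] at h
  simp only [pderiv_X_of_ne (Sum.inl_ne_inr), mul_zero, Finset.sum_const_zero,
    _root_.zero_add] at h
  rw [Finset.sum_eq_single (a := j) (f := fun i => _ * pderiv _ (Sum.inr j) (X (Sum.inr i)))
    (fun b _ hb => by rw [pderiv_X_of_ne (by simpa using hb), mul_zero]) (by simp),
    pderiv_X_self, mul_one] at h
  rw [← coe_substAlgHom hs, map_sum] at h
  simp only [map_mul] at h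
  rw [coe_substAlgHom hs] at h
  rw [subst_comp_subst_apply (hasSubst_of_constantCoeff_zero fun _ => constantCoeff_X _) hs] at h
  simp only [subst_comp_subst_apply (hasSubst_of_constantCoeff_zero hF) hs] at h
  have e1 : (fun s => subst
      (Sum.elim X fun _ => 0 : Fin g ⊕ Fin g → MvPowerSeries (Fin g) (ℚ ⊗[ℤ] B))
      (MvPowerSeries.map θ (𝓕.series s))) = X := by
    ext1 s
    rw [← hθ, ← map_subst hsB, 𝓕.add_zero, MvPowerSeries.map_X]
  have e2 : (fun s : Fin g => subst
      (Sum.elim X fun _ => 0 : Fin g ⊕ Fin g → MvPowerSeries (Fin g) (ℚ ⊗[ℤ] B))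
      (X (Sum.inr s) : MvPowerSeries (Fin g ⊕ Fin g) (ℚ ⊗[ℤ] B))) = fun _ => 0 := by
    ext1 s
    rw [subst_X hs]; rfl
  have e3 (i : Fin g) : subst
      (Sum.elim X fun _ => 0 : Fin g ⊕ Fin g → MvPowerSeries (Fin g) (ℚ ⊗[ℤ] B))
      (pderiv _ (Sum.inr j) (MvPowerSeries.map θ (𝓕.series i))) =
      MvPowerSeries.map θ (𝓕.derivMatrix i j) := by
    rw [← hθ, ← map_pderiv, ← map_subst hsB]; rfl
  rw [e1, e2, subst_self] at h
  simp only [id, e3] at h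
  rw [h, ← Pi.zero_def, subst_zero_eq_C_constantCoeff, ← coeff_zero_eq_constantCoeff_apply, coeff_pderiv,
    _root_.zero_add, hl.linear_eq]
  rcases eq_or_ne k j with rfl | hkj
  · simp
  · simp [hkj, hkj.symm]

/-- The partial derivatives of the logarithm of a formal group law over `B` have coefficients
in `B`. -/
theorem IsLogarithm.exists_pderiv_eq {𝓕 : FormalGroupLaw g B}
    {l : Fin g → MvPowerSeries (Fin g) (ℚ ⊗[ℤ] B)} (hl : 𝓕.IsLogarithm l) (k i : Fin g) :
    ∃ f : MvPowerSeries (Fin g) B, pderiv _ i (l k) = MvPowerSeries.map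
      (Algebra.TensorProduct.includeRight : B →ₐ[ℤ] ℚ ⊗[ℤ] B).toRingHom f := by
  classical
  set θ := MvPowerSeries.map (σ := Fin g)
    (Algebra.TensorProduct.includeRight : B →ₐ[ℤ] ℚ ⊗[ℤ] B).toRingHom
  let D : Matrix (Fin g) (Fin g) (MvPowerSeries (Fin g) (ℚ ⊗[ℤ] B)) :=
    fun k i => pderiv _ i (l k)
  have h1 : D * θ.mapMatrix 𝓕.derivMatrix = 1 := by
    ext1 k j
    rw [Matrix.mul_apply, Matrix.one_apply]
    exact hl.sum_pderiv_mul k j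
  have h2 : 𝓕.derivMatrix * 𝓕.derivMatrix⁻¹ = 1 :=
    Matrix.mul_nonsing_inv _ 𝓕.isUnit_det_derivMatrix
  -- A left inverse equals any right inverse, and the right inverse already exists over `B`.
  have h3 : D = θ.mapMatrix 𝓕.derivMatrix⁻¹ := by
    have := congrArg θ.mapMatrix h2
    rw [map_mul, map_one] at this
    calc D = D * (θ.mapMatrix 𝓕.derivMatrix * θ.mapMatrix 𝓕.derivMatrix⁻¹) := by
          rw [this, mul_one]
      _ = _ := by rw [← mul_assoc, h1, one_mul]
  exact ⟨_, congrFun (congrFun h3 k) i⟩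

end PiJet.FormalGroupLaw

/-! ### Completeness for the `p`-adic topology. -/

namespace PiJet

/-- The additive group `M` is separated and complete for the `p`-adic topology. -/
structure IsPComplete (p : ℕ) (M : Type*) [AddCommGroup M] : Prop where
  eq_zero : ∀ x : M, (∀ n, ∃ y, x = p ^ n • y) → x = 0
  exists_lim : ∀ f : ℕ → M, (∀ n, ∃ y, f (n + 1) - f n = p ^ n • y) →
    ∃ L, ∀ n, ∃ y, L - f n = p ^ n • y

theorem smodEq_span_pow_iff {p : ℕ} {P M : Type*} [CommRing P] [AddCommGroup M] [Module P M]
    {n : ℕ} {x y : M} :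
    x ≡ y [SMOD (Ideal.span {(p : P)} ^ n • ⊤ : Submodule P M)] ↔ ∃ z, x - y = p ^ n • z := by
  rw [SModEq.sub_mem, Ideal.span_singleton_pow, Submodule.ideal_span_singleton_smul,
    Submodule.mem_smul_pointwise_iff_exists]
  constructor
  · rintro ⟨z, -, hz⟩
    exact ⟨z, by rw [← hz, ← Nat.cast_pow, Nat.cast_smul_eq_nsmul]⟩
  · rintro ⟨z, hz⟩
    exact ⟨z, trivial, by rw [hz, ← Nat.cast_pow, Nat.cast_smul_eq_nsmul]⟩

/-- The submodules `p^n M` do not depend on the ring of scalars, so completeness can be moved freely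
between rings and along additive isomorphisms. -/
theorem isPComplete_iff {p : ℕ} (P : Type*) {M : Type*} [CommRing P] [AddCommGroup M]
    [Module P M] : IsPComplete p M ↔ IsAdicComplete (Ideal.span {(p : P)}) M := by
  constructor
  · intro h
    have h1 : IsHausdorff (Ideal.span {(p : P)}) M :=
      ⟨fun x hx => h.eq_zero x fun n => by simpa using smodEq_span_pow_iff.1 (hx n)⟩
    have h2 : IsPrecomplete (Ideal.span {(p : P)}) M := by
      refine ⟨fun f hf => ?_⟩
      obtain ⟨L, hL⟩ := h.exists_lim f fun n =>
        smodEq_span_pow_iff.1 (hf (Nat.le_succ n)).symm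
      exact ⟨L, fun n => (smodEq_span_pow_iff.2 (hL n)).symm⟩
    exact { }
  · intro h
    refine ⟨fun x hx => h.toIsHausdorff.haus x fun n => smodEq_span_pow_iff.2 (by simpa using hx n),
      fun f hf => ?_⟩
    obtain ⟨L, hL⟩ := h.toIsPrecomplete.prec (f := f) fun {m n} hmn => by
      induction n, hmn using Nat.le_induction with
      | base => rfl
      | succ n hmn ih =>
        refine ih.trans ((smodEq_span_pow_iff.2 ?_).symm)
        obtain ⟨y, hy⟩ := hf n
        exact ⟨p ^ (n - m) • y, by rw [hy, smul_smul, ← pow_add, Nat.add_sub_cancel' hmn]⟩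
    exact ⟨L, fun n => smodEq_span_pow_iff.1 (hL n).symm⟩

namespace IsPComplete

variable {p : ℕ} {M N : Type*} [AddCommGroup M] [AddCommGroup N]

theorem of_addEquiv (h : IsPComplete p M) (e : M ≃+ N) : IsPComplete p N := by
  refine ⟨fun x hx => ?_, fun f hf => ?_⟩
  · rw [← e.symm.map_eq_zero_iff]
    refine h.eq_zero _ fun n => ?_
    obtain ⟨y, rfl⟩ := hx n
    exact ⟨e.symm y, map_nsmul _ _ _⟩
  · obtain ⟨L, hL⟩ := h.exists_lim (fun n => e.symm (f n)) fun n => by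
      obtain ⟨y, hy⟩ := hf n
      exact ⟨e.symm y, by rw [← map_sub, hy, map_nsmul]⟩
    refine ⟨e L, fun n => ?_⟩
    obtain ⟨y, hy⟩ := hL n
    refine ⟨e y, ?_⟩
    rw [← map_nsmul, ← hy, map_sub, AddEquiv.apply_symm_apply]

theorem pi {ι : Type*} (h : IsPComplete p M) : IsPComplete p (ι → M) := by
  refine ⟨fun x hx => funext fun i => h.eq_zero _ fun n => ?_, fun f hf => ?_⟩
  · obtain ⟨y, rfl⟩ := hx n
    exact ⟨y i, rfl⟩
  · have (i : ι) := h.exists_lim (fun n => f n i) fun n => by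
      obtain ⟨y, hy⟩ := hf n
      exact ⟨y i, congrFun hy i⟩
    choose L hL using this
    choose y hy using hL
    exact ⟨L, fun n => ⟨fun i => y i n, funext fun i => hy i n⟩⟩

section Ring

variable {C : Type*} [CommRing C]

theorem eq_of_forall_dvd (h : IsPComplete p C) {x y : C} (hxy : ∀ n, (p : C) ^ n ∣ x - y) :
    x = y := by
  rw [← sub_eq_zero]
  refine h.eq_zero _ fun n => ?_
  obtain ⟨z, hz⟩ := hxy n
  exact ⟨z, by rw [hz, nsmul_eq_mul, Nat.cast_pow]⟩

/-- Unordered summation of a family tending to zero. The error bound holds for every finite set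
containing the terms not divisible by `p^n`, so two sums can later be compared over a common index
set. -/
theorem exists_sum (h : IsPComplete p C) {ι : Type*} (t : ι → C)
    (ht : ∀ n, {i | ¬ (p : C) ^ n ∣ t i}.Finite) :
    ∃ x : C, ∀ (n : ℕ) (s : Finset ι), (∀ i ∉ s, (p : C) ^ n ∣ t i) →
      (p : C) ^ n ∣ x - ∑ i ∈ s, t i := by
  classical
  have key (n : ℕ) (s s' : Finset ι) (hss : s ⊆ s') (hs : ∀ i ∉ s, (p : C) ^ n ∣ t i) :
      (p : C) ^ n ∣ ∑ i ∈ s', t i - ∑ i ∈ s, t i := by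
    rw [← Finset.sum_sdiff hss, add_sub_cancel_right]
    exact Finset.dvd_sum fun i hi => hs i (Finset.mem_sdiff.1 hi).2
  have hmem (n : ℕ) (i : ι) (hi : i ∉ (ht n).toFinset) : (p : C) ^ n ∣ t i := by
    simpa using hi
  obtain ⟨x, hx⟩ := h.exists_lim (fun n => ∑ i ∈ (ht n).toFinset, t i) fun n => by
    obtain ⟨y, hy⟩ := key n (ht n).toFinset (ht (n + 1)).toFinset
      (fun i hi => by
        rw [Set.Finite.mem_toFinset, Set.mem_ofPred_eq] at hi ⊢
        exact fun h' => hi ((pow_dvd_pow _ n.le_succ).trans h')) (hmem n)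
    exact ⟨y, by rw [hy, nsmul_eq_mul, Nat.cast_pow]⟩
  refine ⟨x, fun n s hs => ?_⟩
  obtain ⟨y, hy⟩ := hx n
  have h1 := key n (ht n).toFinset s (fun i hi => by
    by_contra h'
    exact (by simpa using hi : ¬ _) (hs i h')) (hmem n)
  have h2 : (p : C) ^ n ∣ x - ∑ i ∈ (ht n).toFinset, t i :=
    ⟨y, by rw [hy, nsmul_eq_mul, Nat.cast_pow]⟩
  have := dvd_sub h2 h1
  rwa [sub_sub_sub_cancel_right] at this

/-- Successive approximation: preimages modulo `p` suffice when source and target are complete. -/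
theorem surjective_of_mod {A : Type*} [CommRing A] (hA : IsPComplete p A) (hC : IsPComplete p C)
    (f : A →+* C) (hf : ∀ c, ∃ a, (p : C) ∣ c - f a) : Function.Surjective f := by
  have h1 := (isPComplete_iff A).1 hA
  have e : (Ideal.span {(p : A)}).map f = Ideal.span {(p : C)} := by
    rw [Ideal.map_span, Set.image_singleton, map_natCast]
  have h2 : IsHausdorff ((Ideal.span {(p : A)}).map f) C := by
    rw [e]; exact ((isPComplete_iff C).1 hC).toIsHausdorff
  refine surjective_of_mk_map_comp_surjective (I := Ideal.span {(p : A)}) f fun c => ?_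
  obtain ⟨c, rfl⟩ := Ideal.Quotient.mk_surjective c
  obtain ⟨a, ha⟩ := hf c
  refine ⟨a, ?_⟩
  rw [RingHom.comp_apply, eq_comm, Ideal.Quotient.mk_eq_mk_iff_sub_mem, e,
    Ideal.mem_span_singleton]
  exact ha

/-- In a `p`-adically complete ring every integer prime to `p` is invertible. -/
theorem isUnit_natCast [Fact p.Prime] (hC : IsPComplete p C) {u : ℕ} (hu : ¬ p ∣ u) :
    IsUnit (u : C) := by
  have := (isPComplete_iff C).1 hC
  -- Completeness puts `p` in the Jacobson radical, so Bézout's relation `a p + b u = 1` makes `u b`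
  -- a unit.
  have h0 : (p : C) ∈ (⊥ : Ideal C).jacobson :=
    IsAdicComplete.le_jacobson_bot _ (Ideal.mem_span_singleton_self _)
  have hc := ((Nat.Prime.coprime_iff_not_dvd Fact.out).2 hu).isCoprime
  obtain ⟨a, b, hab⟩ := hc
  have hab' : (u : C) * b = p * (-a) + 1 := by
    have := congrArg (Int.cast : ℤ → C) hab
    push_cast at this
    linear_combination this
  have := Ideal.mem_jacobson_bot.1 h0 (-(a : C))
  rw [← hab'] at this
  exact isUnit_of_mul_isUnit_left this

end Ring

end IsPComplete

/-! ### The completion of a ring at `p` and its universal property. -/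

section Completion

variable {p : ℕ} {P : Type*} [CommRing P]

theorem span_natCast_fg : (Ideal.span {(p : P)}).FG := ⟨{(p : P)}, by simp⟩

theorem isPComplete_adicCompletion : IsPComplete p (AdicCompletion (Ideal.span {(p : P)}) P) :=
  (isPComplete_iff P).2 (AdicCompletion.isAdicComplete span_natCast_fg)

theorem evalₐ_algebraMap (n : ℕ) (q : P) :
    AdicCompletion.evalₐ (Ideal.span {(p : P)}) n (algebraMap P _ q) = Ideal.Quotient.mk _ q :=
  AdicCompletion.evalₐ_of _ n q

/-- The kernel of the projection modulo `p^n` is generated by `p^n`, because the ideal `(p)` is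
finitely generated. -/
theorem evalₐ_eq_zero_iff {n : ℕ} {x : AdicCompletion (Ideal.span {(p : P)}) P} :
    AdicCompletion.evalₐ _ n x = 0 ↔ (p : AdicCompletion (Ideal.span {(p : P)}) P) ^ n ∣ x := by
  constructor
  · intro h
    have h1 : AdicCompletion.eval (Ideal.span {(p : P)}) P n x = 0 := by
      rw [← AdicCompletion.factor_evalₐ_eq_eval _ x (le_of_eq (Ideal.mul_top _).symm), h, map_zero]
    have h2 : x ∈ (Ideal.span {(p : P)} ^ n • ⊤ :
        Submodule P (AdicCompletion (Ideal.span {(p : P)}) P)) := by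
      rw [AdicCompletion.pow_smul_top_eq_ker_eval span_natCast_fg]
      exact h1
    obtain ⟨z, hz⟩ := smodEq_span_pow_iff.1 (SModEq.sub_mem.2 (by rwa [sub_zero]) :
      x ≡ 0 [SMOD _])
    exact ⟨z, by rw [← sub_zero x, hz, nsmul_eq_mul, Nat.cast_pow]⟩
  · rintro ⟨y, rfl⟩
    rw [map_mul, map_pow, map_natCast]
    have : ((p : P ⧸ Ideal.span {(p : P)} ^ n)) ^ n = 0 := by
      rw [← map_natCast (Ideal.Quotient.mk _), ← map_pow, Ideal.Quotient.eq_zero_iff_mem]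
      exact Ideal.pow_mem_pow (Ideal.mem_span_singleton_self _) n
    rw [this, zero_mul]

theorem evalₐ_eq_mk_iff {n : ℕ} {x : AdicCompletion (Ideal.span {(p : P)}) P} {q : P} :
    AdicCompletion.evalₐ _ n x = Ideal.Quotient.mk _ q ↔
      (p : AdicCompletion (Ideal.span {(p : P)}) P) ^ n ∣ x - algebraMap P _ q := by
  rw [← evalₐ_eq_zero_iff, map_sub, evalₐ_algebraMap, sub_eq_zero]

theorem exists_dvd_sub_algebraMap (n : ℕ) (x : AdicCompletion (Ideal.span {(p : P)}) P) :
    ∃ q : P, (p : AdicCompletion (Ideal.span {(p : P)}) P) ^ n ∣ x - algebraMap P _ q := by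
  obtain ⟨q, hq⟩ := Ideal.Quotient.mk_surjective (AdicCompletion.evalₐ _ n x)
  exact ⟨q, evalₐ_eq_mk_iff.1 hq.symm⟩

theorem pow_dvd_algebraMap_iff {n : ℕ} {q : P} :
    (p : AdicCompletion (Ideal.span {(p : P)}) P) ^ n ∣ algebraMap P _ q ↔ (p : P) ^ n ∣ q := by
  rw [← evalₐ_eq_zero_iff, evalₐ_algebraMap, Ideal.Quotient.eq_zero_iff_mem,
    Ideal.span_singleton_pow, Ideal.mem_span_singleton]

theorem eq_zero_of_natCast_mul_adicCompletion (hP : ∀ q : P, (p : P) * q = 0 → q = 0)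
    {x : AdicCompletion (Ideal.span {(p : P)}) P}
    (hx : (p : AdicCompletion (Ideal.span {(p : P)}) P) * x = 0) : x = 0 := by
  refine isPComplete_adicCompletion.eq_of_forall_dvd fun n => ?_
  rw [sub_zero]
  -- Cancelling `p` loses one power, hence an approximation modulo `p^(n+1)`.
  obtain ⟨q, hq⟩ := exists_dvd_sub_algebraMap (n + 1) x
  have h1 : (p : AdicCompletion (Ideal.span {(p : P)}) P) ^ (n + 1) ∣ algebraMap P _ (p * q) := by
    have := hq.mul_left (p : AdicCompletion (Ideal.span {(p : P)}) P)
    rw [mul_sub, hx, zero_sub, dvd_neg] at this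
    rwa [map_mul, map_natCast]
  obtain ⟨y, hy⟩ := pow_dvd_algebraMap_iff.1 h1
  have h2 : q = p ^ n * y := by
    rw [← sub_eq_zero]
    refine hP _ ?_
    rw [mul_sub, hy]; ring
  have h3 : (p : AdicCompletion (Ideal.span {(p : P)}) P) ^ n ∣ algebraMap P _ q :=
    pow_dvd_algebraMap_iff.2 ⟨y, h2⟩
  exact (dvd_iff_dvd_of_dvd_sub ((pow_dvd_pow _ n.le_succ).trans hq)).2 h3

variable {C : Type*} [CommRing C]

theorem ringHom_eq_of_comp_algebraMap_eq (hC : IsPComplete p C)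
    {f f' : AdicCompletion (Ideal.span {(p : P)}) P →+* C}
    (h : ∀ q, f (algebraMap P _ q) = f' (algebraMap P _ q)) : f = f' := by
  ext x
  refine hC.eq_of_forall_dvd fun n => ?_
  obtain ⟨q, hq⟩ := exists_dvd_sub_algebraMap n x
  have h1 := map_dvd f hq
  have h2 := map_dvd f' hq
  rw [map_pow, map_natCast, map_sub] at h1 h2
  have := dvd_sub h1 h2
  rwa [h, sub_sub_sub_cancel_right] at this

theorem exists_ringHom_adicCompletion (hC : IsPComplete p C) (f : P →+* C) :
    ∃ F : AdicCompletion (Ideal.span {(p : P)}) P →+* C, ∀ q, F (algebraMap P _ q) = f q := by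
  have := (isPComplete_iff C).1 hC
  have hle (n : ℕ) : Ideal.span {(p : P)} ^ n ≤ (Ideal.span {(p : C)} ^ n).comap f := by
    rw [Ideal.span_singleton_pow, Ideal.span_singleton_pow, Ideal.span_singleton_le_iff_mem,
      Ideal.mem_comap, map_pow, map_natCast]
    exact Ideal.mem_span_singleton_self _
  let F (n : ℕ) : AdicCompletion (Ideal.span {(p : P)}) P →+* C ⧸ Ideal.span {(p : C)} ^ n :=
    (Ideal.quotientMap _ f (hle n)).comp
      (AdicCompletion.evalₐ (Ideal.span {(p : P)}) n : _ →+* _)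
  have hF {m n : ℕ} (hmn : m ≤ n) : (Ideal.Quotient.factorPow _ hmn).comp (F n) = F m := by
    ext x
    obtain ⟨q, hq⟩ := exists_dvd_sub_algebraMap n x
    have h1 := evalₐ_eq_mk_iff.2 hq
    have h2 := evalₐ_eq_mk_iff.2 ((pow_dvd_pow _ hmn).trans hq)
    simp only [F, RingHom.comp_apply, RingHom.coe_coe, h1, h2, Ideal.quotientMap_mk]
    rfl
  refine ⟨IsAdicComplete.liftRingHom _ F hF, fun q => hC.eq_of_forall_dvd fun n => ?_⟩
  rw [← Ideal.mem_span_singleton, ← Ideal.span_singleton_pow, ← Ideal.Quotient.mk_eq_mk_iff_sub_mem,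
    IsAdicComplete.mk_liftRingHom]
  simp only [F, RingHom.comp_apply, RingHom.coe_coe, evalₐ_algebraMap, Ideal.quotientMap_mk]

end Completion

/-! ### Finite free base change. -/

section BaseChange

variable {O O' B : Type*} [CommRing O] [CommRing O'] [Algebra O O'] [Module.Free O O']
  [Module.Finite O O'] [CommRing B] [Algebra O B] {p : ℕ}

-- A finite power of `B` as an additive group is all that completeness and torsion-freeness require;
-- no compatibility with products is needed.
variable (O O' B) in
noncomputable def tensorAddEquivPi :
    O' ⊗[O] B ≃+ (Module.Free.ChooseBasisIndex O O' → B) := by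
  classical
  exact ((TensorProduct.comm O O' B).trans ((TensorProduct.congr (LinearEquiv.refl O B)
    (Module.Free.chooseBasis O O').equivFun).trans
      (TensorProduct.piScalarRight O O B _))).toAddEquiv

theorem IsPComplete.tensor (h : IsPComplete p B) : IsPComplete p (O' ⊗[O] B) :=
  h.pi.of_addEquiv (tensorAddEquivPi O O' B).symm

theorem eq_zero_of_natCast_mul_tensor (h : ∀ q : B, (p : B) * q = 0 → q = 0) (z : O' ⊗[O] B)
    (hz : (p : O' ⊗[O] B) * z = 0) : z = 0 := by
  let e := tensorAddEquivPi O O' B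
  rw [← e.map_eq_zero_iff]
  rw [← nsmul_eq_mul, ← e.map_eq_zero_iff, map_nsmul] at hz
  funext i
  exact h _ (by rw [← nsmul_eq_mul]; exact congrFun hz i)

end BaseChange

theorem isNoetherianRing_tensor {O O' B : Type*} [CommRing O] [CommRing O'] [Algebra O O']
    [Module.Finite O O'] [CommRing B] [Algebra O B] [IsNoetherianRing B] : IsNoetherianRing (O' ⊗[O] B) := by
  have : IsNoetherianRing (B ⊗[O] O') := IsNoetherianRing.of_finite B _
  exact isNoetherianRing_of_ringEquiv _ (Algebra.TensorProduct.comm O B O').toRingEquiv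

/-- This makes the universal property of `S_π^*` applicable to `R_π ⊗ S^*`. -/
theorem ProlSeq.InProl.baseChange {p : ℕ} [Fact p.Prime] {O O' : Type} [CommRing O] [CommRing O']
    [Algebra O O'] [Module.Free O O'] [Module.Finite O O'] {F : FrobeniusBase p O}
    {F' : FrobeniusBase p O'} {S : ProlSeq.{u} F} (hS : S.InProl) (h : F.Extends F') :
    (S.baseChange h hS.flat).InProl where
  noetherian r := by
    have := hS.noetherian r
    exact isNoetherianRing_tensor (O := O) (O' := O') (B := S.obj r)
  complete r := by
    have h1 : IsPComplete p (O' ⊗[O] S.obj r) :=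
      ((isPComplete_iff (S.obj r)).2 (hS.complete r)).tensor
    have h2 := (isPComplete_iff (O' ⊗[O] S.obj r)).1 h1
    exact h2
  flat r := by
    have := hS.flat r
    exact (inferInstance : Module.Flat O' (O' ⊗[O] S.obj r))

end PiJet

namespace PiJet

/-! ### Estimates for the denominators. -/

section Arithmetic

/-- The source of the constant `ν`. Writing `m = s + 1 + t`, one has `t e ≤ p^t p^(s+1) = p^m ≤ n`.
-/
theorem le_add_div_of_pow_le {p e s m n : ℕ} (hp : 2 ≤ p) (he : e < p ^ (s + 1)) (he0 : 0 < e)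
    (h : p ^ m ≤ n) : m ≤ s + 1 + n / e := by
  rcases le_or_gt m (s + 1) with hm | hm
  · exact hm.trans (Nat.le_add_right _ _)
  obtain ⟨t, rfl⟩ := Nat.exists_eq_add_of_le hm.le
  have : t ≤ n / e := by
    rw [Nat.le_div_iff_mul_le he0]
    calc t * e ≤ p ^ t * p ^ (s + 1) :=
          Nat.mul_le_mul (Nat.lt_pow_self (by omega)).le he.le
      _ = p ^ (s + 1 + t) := by rw [← pow_add, add_comm]
      _ ≤ n := h
  omega

/-- Split `2^m` into two factors `2^(m/2)`: one dominates the constant `e (N + 2)`, the other the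
linear term `m/2 + 1`. -/
theorem mul_add_le_two_pow {e N m : ℕ} (h : 2 * (e * (N + 2)) ≤ m) : e * (N + m) ≤ 2 ^ m := by
  set c := e * (N + 2)
  have h1 : m / 2 + 1 ≤ 2 ^ (m / 2) := Nat.lt_pow_self (by norm_num)
  calc e * (N + m) ≤ e * (N + 2 * (m / 2 + 1)) := by gcongr; omega
    _ ≤ e * ((N + 2) * (m / 2 + 1)) := by gcongr; nlinarith [Nat.zero_le (N * (m / 2))]
    _ = c * (m / 2 + 1) := by ring
    _ ≤ 2 ^ (m / 2) * 2 ^ (m / 2) := Nat.mul_le_mul (by omega) h1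
    _ = 2 ^ (m / 2 * 2) := by rw [← pow_add, mul_two]
    _ ≤ 2 ^ m := Nat.pow_le_pow_right (by norm_num) (Nat.div_mul_le_self m 2)

/-- `n/e - m` tends to infinity with `n`, uniformly in `m` with `p^m ≤ n`: large `m` force `n` to be
exponentially large, and the remaining `m` are bounded. It gives convergence both over `R` (with `e
= 1`) and over `R_π`. -/
theorem exists_forall_add_le_div {p e : ℕ} (hp : 2 ≤ p) (he0 : 0 < e) (N : ℕ) :
    ∃ k, ∀ n, k ≤ n → ∀ m, p ^ m ≤ n → N + m ≤ n / e := by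
  set M := 2 * (e * (N + 2))
  refine ⟨e * (N + M), fun n hn m hm => ?_⟩
  rw [Nat.le_div_iff_mul_le he0, mul_comm]
  rcases le_or_gt M m with h | h
  · exact (mul_add_le_two_pow h).trans ((Nat.pow_le_pow_left hp m).trans hm)
  · refine le_trans ?_ hn
    gcongr

theorem lt_pow_floor_log {p e : ℕ} (hp : 2 ≤ p) (he0 : 0 < e) :
    e < p ^ (⌊Real.log e / Real.log p⌋₊ + 1) := by
  have hlog : 0 < Real.log p := Real.log_pos (by exact_mod_cast hp)
  have h := Nat.lt_floor_add_one (Real.log e / Real.log p)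
  rw [div_lt_iff₀ hlog] at h
  have he : (0 : ℝ) < e := by exact_mod_cast he0
  have hp0 : (0 : ℝ) < p := by exact_mod_cast (by omega : 0 < p)
  rw [← Nat.cast_add_one, ← Real.log_pow, Real.log_lt_log_iff he (by positivity)] at h
  exact_mod_cast h

end Arithmetic

/-! ### Iterates of `φ` on polynomials in the `δ^j T`. -/

section PhiPoly

variable {p g : ℕ}

theorem phiPoly_C {O : Type*} [CommRing O] (θ : O →+* O) (a : O) :
    phiPoly p g θ (MvPolynomial.C a) = MvPolynomial.C (θ a) := by
  simp [phiPoly]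

theorem phiPoly_X {O : Type*} [CommRing O] (θ : O →+* O) (jk : ℕ × Fin g) :
    phiPoly p g θ (MvPolynomial.X jk) =
      MvPolynomial.X jk ^ p + (p : MvPolynomial (ℕ × Fin g) O) *
        MvPolynomial.X (jk.1 + 1, jk.2) := by
  simp only [phiPoly, MvPolynomial.coe_eval₂Hom, MvPolynomial.eval₂_X]

theorem constantCoeff_phiPoly (hp : p ≠ 0) (z : MvPolynomial (ℕ × Fin g) ℤ) :
    MvPolynomial.constantCoeff (phiPoly p g (RingHom.id ℤ) z) =
      MvPolynomial.constantCoeff z := by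
  induction z using MvPolynomial.induction_on with
  | C a => simp
  | add a b ha hb => rw [map_add, map_add, map_add, ha, hb]
  | mul_X a n ha => rw [map_mul, map_mul, map_mul, ha, phiPoly_X]; simp [hp]

theorem constantCoeff_iterate_phiPoly (hp : p ≠ 0) (r : ℕ) (i : Fin g) :
    MvPolynomial.constantCoeff
      ((phiPoly p g (RingHom.id ℤ))^[r] (MvPolynomial.X (0, i))) = 0 := by
  induction r with
  | zero => simp
  | succ r ih => rw [Function.iterate_succ_apply', constantCoeff_phiPoly hp, ih]

theorem exists_iterate_phiPoly_eq (r : ℕ) (i : Fin g) :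
    ∃ q : MvPolynomial (ℕ × Fin g) ℤ,
      (phiPoly p g (RingHom.id ℤ))^[r] (MvPolynomial.X (0, i)) =
        MvPolynomial.X (0, i) ^ p ^ r + (p : MvPolynomial (ℕ × Fin g) ℤ) * q := by
  induction r with
  | zero => exact ⟨0, by simp⟩
  | succ r ih =>
    obtain ⟨q, hq⟩ := ih
    rw [Function.iterate_succ_apply', hq, map_add, map_pow, map_mul, map_natCast, phiPoly_X]
    set T : MvPolynomial (ℕ × Fin g) ℤ := MvPolynomial.X (0, i)
    set T' : MvPolynomial (ℕ × Fin g) ℤ := MvPolynomial.X (0 + 1, i)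
    -- `φ(T)` and `T^p` differ by `p T'`, so `p T'` divides the difference of their powers.
    obtain ⟨w, hw⟩ := sub_dvd_pow_sub_pow (T ^ p + p * T') (T ^ p) (p ^ r)
    refine ⟨T' * w + phiPoly p g (RingHom.id ℤ) q, ?_⟩
    have e : T ^ p ^ (r + 1) = (T ^ p) ^ p ^ r := by rw [← pow_mul, ← pow_succ']
    rw [e]
    linear_combination hw

/-- The polynomial `P_i` with `φ^r(T_i)|_{T = 0} = p P_i`. -/
noncomputable def jetPoly (p : ℕ) {g : ℕ} (r : ℕ) (B : Type*) [CommRing B] (i : Fin g) :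
    MvPolynomial (Fin r × Fin g) B :=
  MvPolynomial.aeval (atZero r g B) (exists_iterate_phiPoly_eq (p := p) r i).choose

theorem aeval_atZero_iterate_phiPoly (hp : p ≠ 0) (r : ℕ) (B : Type*) [CommRing B] (i : Fin g) :
    MvPolynomial.aeval (atZero r g B)
      ((phiPoly p g (RingHom.id ℤ))^[r] (MvPolynomial.X (0, i))) =
      (p : MvPolynomial (Fin r × Fin g) B) * jetPoly p r B i := by
  have h0 : atZero r g B (0, i) = 0 := by simp [atZero]
  rw [(exists_iterate_phiPoly_eq (p := p) r i).choose_spec, map_add, map_pow, map_mul,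
    MvPolynomial.aeval_X, h0, zero_pow (pow_ne_zero _ hp), map_natCast, zero_add]
  rfl

theorem map_atZero {B B' : Type*} [CommRing B] [CommRing B'] (θ : B →+* B') (r : ℕ)
    (jk : ℕ × Fin g) : MvPolynomial.map θ (atZero r g B jk) = atZero r g B' jk := by
  unfold atZero
  split_ifs <;> simp

theorem map_aeval_atZero {B B' : Type*} [CommRing B] [CommRing B'] (θ : B →+* B') (r : ℕ)
    (z : MvPolynomial (ℕ × Fin g) ℤ) :
    MvPolynomial.map θ (MvPolynomial.aeval (atZero r g B) z) =
      MvPolynomial.aeval (atZero r g B') z := by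
  induction z using MvPolynomial.induction_on with
  | C a => simp
  | add a b ha hb => rw [map_add, map_add, map_add, ha, hb]
  | mul_X a n ha => rw [map_mul, map_mul, map_mul, ha, MvPolynomial.aeval_X, map_atZero,
      MvPolynomial.aeval_X]

theorem constantCoeff_aeval_atZero (B : Type*) [CommRing B] (r : ℕ)
    (z : MvPolynomial (ℕ × Fin g) ℤ) :
    MvPolynomial.constantCoeff (MvPolynomial.aeval (atZero r g B) z) =
      ((MvPolynomial.constantCoeff z : ℤ) : B) := by
  induction z using MvPolynomial.induction_on with
  | C a => simp
  | add a b ha hb => rw [map_add, map_add, map_add, ha, hb, Int.cast_add]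
  | mul_X a n ha =>
    rw [map_mul, map_mul, map_mul, ha, MvPolynomial.aeval_X, atZero]
    split_ifs <;> simp

theorem map_phiPoly {O : Type*} [CommRing O] (θ : O →+* O) (z : MvPolynomial (ℕ × Fin g) ℤ) :
    MvPolynomial.map (Int.castRingHom O) (phiPoly p g (RingHom.id ℤ) z) =
      phiPoly p g θ (MvPolynomial.map (Int.castRingHom O) z) := by
  induction z using MvPolynomial.induction_on with
  | C a => simp
  | add a b ha hb => simp only [map_add, ha, hb]
  | mul_X a n ha => simp only [map_mul, ha, phiPoly_X, MvPolynomial.map_X, map_add, map_pow,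
      map_natCast]

/-- `φ^r(T_i)` has integer coefficients, so it is the same polynomial over every base. This allows
its expressions through `p` and through `π` to be equated. -/
theorem map_iterate_phiPoly {O : Type*} [CommRing O] (θ : O →+* O) (r : ℕ) (i : Fin g) :
    MvPolynomial.map (Int.castRingHom O)
      ((phiPoly p g (RingHom.id ℤ))^[r] (MvPolynomial.X (0, i))) =
      (phiPoly p g θ)^[r] (MvPolynomial.X (0, i)) := by
  induction r with
  | zero => simp
  | succ r ih => rw [Function.iterate_succ_apply', map_phiPoly θ, ih, Function.iterate_succ_apply']

variable [Fact p.Prime] {O : Type*} [CommRing O] (F : FrobeniusBase p O)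

theorem phiPoly_deltaPoly (j : ℕ) (k : Fin g) :
    phiPoly p g F.φ (deltaPoly g F j k) =
      deltaPoly g F j k ^ p + MvPolynomial.C F.ϖ * deltaPoly g F (j + 1) k := by
  have h : phiPoly p g F.φ (deltaPoly g F j k) - deltaPoly g F j k ^ p =
      MvPolynomial.C F.ϖ * deltaPoly g F (j + 1) k :=
    (phiPoly_dvd g F (deltaPoly g F j k)).choose_spec
  rw [← h]; ring

variable (g) in
/-- The `O`-algebra generated by the polynomials expressing `δ_π^j T_k` for `j ≤ m`. -/
noncomputable def deltaSubalgebra (m : ℕ) : Subalgebra O (MvPolynomial (ℕ × Fin g) O) :=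
  Algebra.adjoin O {z | ∃ j ≤ m, ∃ k, z = deltaPoly g F j k}

theorem deltaPoly_mem {j m : ℕ} (h : j ≤ m) (k : Fin g) :
    deltaPoly g F j k ∈ deltaSubalgebra g F m :=
  Algebra.subset_adjoin ⟨j, h, k, rfl⟩

theorem C_mem_deltaSubalgebra (m : ℕ) (a : O) :
    MvPolynomial.C a ∈ deltaSubalgebra g F m :=
  Subalgebra.algebraMap_mem _ a

theorem phiPoly_mem {m : ℕ} {z : MvPolynomial (ℕ × Fin g) O}
    (hz : z ∈ deltaSubalgebra g F m) : phiPoly p g F.φ z ∈ deltaSubalgebra g F (m + 1) := by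
  induction hz using Algebra.adjoin_induction with
  | mem z hz =>
    obtain ⟨j, hj, k, rfl⟩ := hz
    rw [phiPoly_deltaPoly]
    exact add_mem (pow_mem (deltaPoly_mem F (by omega) k) _)
      (mul_mem (C_mem_deltaSubalgebra F _ _) (deltaPoly_mem F (by omega) k))
  | algebraMap a =>
    rw [MvPolynomial.algebraMap_eq, phiPoly_C]
    exact C_mem_deltaSubalgebra F _ _
  | add x y _ _ hx hy => rw [map_add]; exact add_mem hx hy
  | mul x y _ _ hx hy => rw [map_mul]; exact mul_mem hx hy

/-- The ramified form of `φ^r(T) ≡ T^(p^r)`. The induction works since `φ(ϖ)` is a multiple of `ϖ`;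
the point is that the quotient is a polynomial in the `δ_π^j T` with `j ≤ r`. -/
theorem exists_iterate_phiPoly_eq_deltaPoly (r : ℕ) (i : Fin g) :
    ∃ q ∈ deltaSubalgebra g F r, (phiPoly p g F.φ)^[r] (MvPolynomial.X (0, i)) =
      MvPolynomial.X (0, i) ^ p ^ r + MvPolynomial.C F.ϖ * q := by
  induction r with
  | zero => exact ⟨0, zero_mem _, by simp⟩
  | succ r ih =>
    obtain ⟨q, hqm, hq⟩ := ih
    have hp0 : p ≠ 0 := (Fact.out : p.Prime).ne_zero
    have hT : phiPoly p g F.φ (MvPolynomial.X (0, i)) = MvPolynomial.X (0, i) ^ p +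
        MvPolynomial.C F.ϖ * deltaPoly g F 1 i := phiPoly_deltaPoly F 0 i
    have hϖ : F.φ F.ϖ = F.ϖ * (F.ϖ ^ (p - 1) + F.δ F.ϖ) := by
      rw [F.φ_eq, mul_add, ← pow_succ', Nat.sub_add_cancel (by omega)]
    rw [Function.iterate_succ_apply', hq, map_add, map_pow, map_mul, phiPoly_C, hT, hϖ]
    -- Working inside the subalgebra keeps the quotient `w` in it.
    set D := deltaSubalgebra g F (r + 1)
    let T : D := ⟨MvPolynomial.X (0, i), deltaPoly_mem F (Nat.zero_le _) i⟩
    let T' : D := ⟨deltaPoly g F 1 i, deltaPoly_mem F (by omega) i⟩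
    let c : D := ⟨MvPolynomial.C F.ϖ, C_mem_deltaSubalgebra F _ _⟩
    let q' : D := ⟨_, phiPoly_mem F hqm⟩
    let u : D := ⟨MvPolynomial.C (F.ϖ ^ (p - 1) + F.δ F.ϖ), C_mem_deltaSubalgebra F _ _⟩
    obtain ⟨w, hw⟩ := sub_dvd_pow_sub_pow (T ^ p + c * T') (T ^ p) (p ^ r)
    refine ⟨(T' * w + u * q' : D), Subtype.property _, ?_⟩
    have e : (T ^ p + c * T') ^ p ^ r + c * u * q' = T ^ p ^ (r + 1) + c * (T' * w + u * q') := by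
      have e : T ^ p ^ (r + 1) = (T ^ p) ^ p ^ r := by rw [← pow_mul, ← pow_succ']
      rw [e]
      linear_combination hw
    rw [map_mul]
    exact congrArg Subtype.val e

end PhiPoly

/-! ### Ramification of `R_π`. -/

section Ramified

variable {p : ℕ} [Fact p.Prime] {π : Kalg p}

theorem finite_Rpi (hπ : IsPi π) : Module.Finite (R p) (Rpi π) :=
  (Algebra.adjoin.powerBasis' (isIntegral_pi hπ)).finite

theorem free_Rpi (hπ : IsPi π) : Module.Free (R p) (Rpi π) :=
  Module.Free.of_basis (Algebra.adjoin.powerBasis' (isIntegral_pi hπ)).basis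

/-- The Eisenstein polynomial is the minimal polynomial of `π`, so its degree is `e`; all its
non-leading coefficients are divisible by `p`. -/
theorem exists_pi_pow_ramIndex (hπ : IsPi π) :
    ∃ w : Rpi π, piElt π ^ ramIndex π = p * w := by
  have hint := isIntegral_pi hπ
  obtain ⟨⟨f, hm, he, -, h0⟩, -⟩ := hπ
  have hd : ramIndex π = (f.map (algebraMap (R p) (Kalg p))).natDegree := by
    rw [ramIndex, IntermediateField.adjoin.finrank hint.tower_top,
      minpoly.isIntegrallyClosed_eq_field_fractions' (K p) hint, minpoly_eq hm he h0,
      hm.natDegree_map, hm.natDegree_map]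
  obtain ⟨y, hy, h⟩ := he.isWeaklyEisensteinAt.exists_mem_adjoin_mul_eq_pow_natDegree h0 hm
  refine ⟨⟨y, hy⟩, Subtype.ext ?_⟩
  change π ^ _ = ((p : Rpi π) : Kalg p) * y
  rw [hd, ← h, map_natCast]; rfl

theorem ramIndex_pos (hπ : IsPi π) : 0 < ramIndex π := by
  have := IntermediateField.adjoin.finiteDimensional
    ((isIntegral_pi hπ).tower_top : IsIntegral (K p) π)
  exact Module.finrank_pos

theorem exists_pi_pow_eq (hπ : IsPi π) (n : ℕ) :
    ∃ w : Rpi π, piElt π ^ n = p ^ (n / ramIndex π) * w := by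
  obtain ⟨w, hw⟩ := exists_pi_pow_ramIndex hπ
  refine ⟨w ^ (n / ramIndex π) * piElt π ^ (n % ramIndex π), ?_⟩
  conv_lhs => rw [← Nat.div_add_mod n (ramIndex π), pow_add, pow_mul, hw, mul_pow]
  ring

end Ramified

end PiJet

/-! ### Term-by-term expansion of `L^r`. -/

namespace PiJet

section Logarithm

variable {p : ℕ} [Fact p.Prime] {g : ℕ}

/-- The denominators of the logarithm: the coefficient at `T ^ α` is of the form `b / p ^ m` with
`p ^ m ≤ |α|`. -/
theorem FormalGroupLaw.IsLogarithm.exists_pow_mul_coeff {B : Type*} [CommRing B]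
    (hB : IsPComplete p B) {𝓕 : FormalGroupLaw g B}
    {l : Fin g → MvPowerSeries (Fin g) (ℚ ⊗[ℤ] B)} (hl : 𝓕.IsLogarithm l) (k : Fin g)
    (α : Fin g →₀ ℕ) : ∃ (m : ℕ) (b : B),
      (p : ℚ ⊗[ℤ] B) ^ m * MvPowerSeries.coeff α (l k) = 1 ⊗ₜ b ∧
      (p ^ m ≤ α.degree ∨ (m = 0 ∧ b = 0)) := by
  by_cases hα : α = 0
  -- The constant term vanishes, and `p^0 ≤ 0` fails, hence the second alternative.
  · refine ⟨0, 0, ?_, Or.inr ⟨rfl, rfl⟩⟩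
    rw [hα, MvPowerSeries.coeff_zero_eq_constantCoeff_apply, hl.constantCoeff_eq, mul_zero,
      TensorProduct.tmul_zero]
  obtain ⟨j, hj⟩ : ∃ j, α j ≠ 0 := by
    by_contra! h
    exact hα (Finsupp.ext h)
  obtain ⟨n, hn⟩ : ∃ n, α = n + Finsupp.single j 1 :=
    ⟨α - Finsupp.single j 1, (tsub_add_cancel_of_le (by
      rw [Finsupp.single_le_iff]; omega)).symm⟩
  -- The coefficient of `∂l_k/∂T_j` at `α - e_j` is `α_j = p^m u` times that of `l_k` at `α`; the
  -- factor `u` is a unit.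
  obtain ⟨m, u, hu, hmu⟩ := Nat.exists_eq_pow_mul_and_not_dvd hj p (Fact.out : p.Prime).ne_one
  obtain ⟨f, hf⟩ := hl.exists_pderiv_eq k j
  obtain ⟨w, hw⟩ := (hB.isUnit_natCast hu).exists_right_inv
  have h1 := congrArg (MvPowerSeries.coeff n) hf
  rw [MvPowerSeries.coeff_pderiv, ← hn, MvPowerSeries.coeff_map] at h1
  have h2 : ((n j : ℚ ⊗[ℤ] B) + 1) = (p : ℚ ⊗[ℤ] B) ^ m * u := by
    have : n j + 1 = p ^ m * u := by rw [← hmu, hn]; simp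
    exact_mod_cast congrArg (Nat.cast : ℕ → ℚ ⊗[ℤ] B) this
  change _ = (1 : ℚ) ⊗ₜ[ℤ] (MvPowerSeries.coeff n f) at h1
  have h3 : (u : ℚ ⊗[ℤ] B) * ((1 : ℚ) ⊗ₜ[ℤ] w) = 1 := by
    have := congrArg (Algebra.TensorProduct.includeRight : B →ₐ[ℤ] ℚ ⊗[ℤ] B) hw
    rw [map_mul, map_natCast, map_one] at this
    exact this
  refine ⟨m, w * MvPowerSeries.coeff n f, ?_, Or.inl ?_⟩
  · have h4 : (1 : ℚ) ⊗ₜ[ℤ] (w * MvPowerSeries.coeff n f) =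
        ((1 : ℚ) ⊗ₜ[ℤ] w) * ((1 : ℚ) ⊗ₜ[ℤ] MvPowerSeries.coeff n f) := by
      rw [Algebra.TensorProduct.tmul_mul_tmul, mul_one]
    rw [h4, ← h1, h2]
    linear_combination (-(p : ℚ ⊗[ℤ] B) ^ m * MvPowerSeries.coeff α (l k)) * h3
  · calc p ^ m ≤ p ^ m * u := Nat.le_mul_of_pos_right _ (Nat.pos_of_ne_zero fun h => hu (h ▸ dvd_zero p))
      _ = α j := hmu.symm
      _ ≤ α.degree := Finsupp.le_degree j α

theorem finsupp_prod_mul_pow {B ι : Type*} [CommRing B] (α : ι →₀ ℕ) (c : B) (q : ι → B) :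
    (α.prod fun i n => (c * q i) ^ n) = c ^ α.degree * α.prod fun i n => q i ^ n := by
  simp only [mul_pow, Finsupp.prod_mul]
  rw [Finsupp.prod, Finset.prod_pow_eq_pow_sum, Finsupp.degree_apply]

/-- The term of `L^r` coming from a term `(c / p ^ m) T ^ α` of the logarithm with
`φ^r(c) = b`. -/
noncomputable def jetTerm (p r m : ℕ) {B : Type*} [CommRing B] (b : B) (α : Fin g →₀ ℕ) :
    MvPolynomial (Fin r × Fin g) B :=
  MvPolynomial.C ((p : B) ^ (α.degree - 1 - m) * b) * α.prod fun i n => jetPoly p r B i ^ n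

/-- The truncated subtraction in the exponent of `jetTerm` is harmless: either `m + 1 ≤ |α|`, or the
coefficient is zero. -/
theorem pow_mul_jetTerm (p r : ℕ) {B : Type*} [CommRing B] {m : ℕ} {b : B} {α : Fin g →₀ ℕ}
    (h : m + 1 ≤ α.degree ∨ b = 0) :
    (p : MvPolynomial (Fin r × Fin g) B) ^ (m + 1) * jetTerm p r m b α =
      MvPolynomial.C b * α.prod fun i n =>
        ((p : MvPolynomial (Fin r × Fin g) B) * jetPoly p r B i) ^ n := by
  rcases h with h | rfl
  · rw [finsupp_prod_mul_pow, jetTerm]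
    obtain ⟨d, hd⟩ := Nat.exists_eq_add_of_le h
    rw [hd, show m + 1 + d - 1 - m = d by omega, pow_add (_ : MvPolynomial _ _), map_mul, map_pow,
      map_natCast]
    ring
  · simp [jetTerm]

theorem coeff_subst_jetPoly {B₀ B : Type*} [CommRing B₀] [CommRing B] (ψ : B₀ →+* B)
    (f : MvPowerSeries (Fin g) (ℚ ⊗[ℤ] B₀)) (r : ℕ) {m : (Fin g →₀ ℕ) → ℕ}
    {b : (Fin g →₀ ℕ) → B₀}
    (hb : ∀ α, (p : ℚ ⊗[ℤ] B₀) ^ m α * MvPowerSeries.coeff α f = 1 ⊗ₜ b α)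
    (hm : ∀ α, m α + 1 ≤ α.degree ∨ b α = 0) (β : Fin r × Fin g →₀ ℕ) :
    (fun α => (1 : ℚ) ⊗ₜ[ℤ]
      MvPolynomial.coeff β (jetTerm p r (m α) (ψ (b α)) α)).HasFiniteSupport ∧
    MvPowerSeries.coeff β ((p : ℚ)⁻¹ • MvPowerSeries.subst
      (fun i => ((MvPolynomial.aeval (atZero r g (ℚ ⊗[ℤ] B))
        ((phiPoly p g (RingHom.id ℤ))^[r] (MvPolynomial.X (0, i))) :
          MvPolynomial (Fin r × Fin g) (ℚ ⊗[ℤ] B)) :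
            MvPowerSeries (Fin r × Fin g) (ℚ ⊗[ℤ] B)))
      (MvPowerSeries.map
        (Algebra.TensorProduct.map (AlgHom.id ℤ ℚ) ψ.toIntAlgHom).toRingHom f)) =
      ∑ᶠ α, (1 : ℚ) ⊗ₜ[ℤ] MvPolynomial.coeff β (jetTerm p r (m α) (ψ (b α)) α) := by
  have hp0 : p ≠ 0 := (Fact.out : p.Prime).ne_zero
  set θ : B →+* ℚ ⊗[ℤ] B :=
    (Algebra.TensorProduct.includeRight : B →ₐ[ℤ] ℚ ⊗[ℤ] B).toRingHom with hθ
  set Φ : ℚ ⊗[ℤ] B₀ →+* ℚ ⊗[ℤ] B :=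
    (Algebra.TensorProduct.map (AlgHom.id ℤ ℚ) ψ.toIntAlgHom).toRingHom with hΦ
  set a : Fin g → MvPowerSeries (Fin r × Fin g) (ℚ ⊗[ℤ] B) := fun i =>
    ((MvPolynomial.aeval (atZero r g (ℚ ⊗[ℤ] B))
      ((phiPoly p g (RingHom.id ℤ))^[r] (MvPolynomial.X (0, i))) :
        MvPolynomial (Fin r × Fin g) (ℚ ⊗[ℤ] B)) : MvPowerSeries (Fin r × Fin g) (ℚ ⊗[ℤ] B))
  have ha0 (i : Fin g) : MvPowerSeries.constantCoeff (a i) = 0 := by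
    have : MvPowerSeries.constantCoeff (a i) = MvPolynomial.constantCoeff
        (MvPolynomial.aeval (atZero r g (ℚ ⊗[ℤ] B))
          ((phiPoly p g (RingHom.id ℤ))^[r] (MvPolynomial.X (0, i)))) := rfl
    rw [this]
    refine (constantCoeff_aeval_atZero (ℚ ⊗[ℤ] B) r _).trans ?_
    rw [constantCoeff_iterate_phiPoly hp0, Int.cast_zero]
  have hs := MvPowerSeries.hasSubst_of_constantCoeff_zero ha0
  have ha (i : Fin g) : a i = (MvPolynomial.coeToMvPowerSeries.ringHom.comp (MvPolynomial.map θ))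
      ((p : MvPolynomial (Fin r × Fin g) B) * jetPoly p r B i) := by
    rw [← aeval_atZero_iterate_phiPoly hp0, RingHom.comp_apply, map_aeval_atZero]
    rfl
  have hprod (α : Fin g →₀ ℕ) : MvPowerSeries.coeff β (α.prod fun i n => a i ^ n) =
      θ (MvPolynomial.coeff β (α.prod fun i n =>
        ((p : MvPolynomial (Fin r × Fin g) B) * jetPoly p r B i) ^ n)) := by
    simp only [ha, ← map_pow]
    rw [← map_finsuppProd, RingHom.comp_apply]
    change MvPolynomial.coeff β (MvPolynomial.map θ _) = _
    rw [MvPolynomial.coeff_map]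
  have hfin := MvPowerSeries.coeff_subst_finite hs (MvPowerSeries.map Φ f) β
  have e2 (n : ℕ) (x : ℚ ⊗[ℤ] B) : (p : ℚ) ^ n • x = (p : ℚ ⊗[ℤ] B) ^ n * x := by
    refine (Algebra.smul_def ((p : ℚ) ^ n) x).trans ?_
    rw [map_pow, map_natCast]
  have hterm (α : Fin g →₀ ℕ) : (p : ℚ)⁻¹ • (MvPowerSeries.coeff α (MvPowerSeries.map Φ f) •
      MvPowerSeries.coeff β (α.prod fun i n => a i ^ n)) =
      (1 : ℚ) ⊗ₜ[ℤ] MvPolynomial.coeff β (jetTerm p r (m α) (ψ (b α)) α) := by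
    have hpQ : (p : ℚ) ^ (m α + 1) ≠ 0 := pow_ne_zero _ (by exact_mod_cast hp0)
    -- All denominators are cleared by `p^(m+1)`, which acts injectively on a `ℚ`-vector space.
    refine smul_right_injective _ hpQ ?_
    change (p : ℚ) ^ (m α + 1) • _ = (p : ℚ) ^ (m α + 1) • θ _
    have e1 : (p : ℚ) ^ (m α + 1) * (p : ℚ)⁻¹ = (p : ℚ) ^ m α := by
      rw [pow_succ, mul_assoc, mul_inv_cancel₀ (by exact_mod_cast hp0), mul_one]
    have e3 : (p : ℚ ⊗[ℤ] B) ^ m α * MvPowerSeries.coeff α (MvPowerSeries.map Φ f) =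
        θ (ψ (b α)) := by
      have := congrArg Φ (hb α)
      rw [map_mul, map_pow, map_natCast] at this
      rw [MvPowerSeries.coeff_map, this]
      rfl
    have hm' : m α + 1 ≤ α.degree ∨ ψ (b α) = 0 := (hm α).imp_right fun h => by rw [h, map_zero]
    rw [smul_smul, e1, e2, e2, smul_eq_mul, ← mul_assoc, e3, hprod, ← map_mul,
      ← MvPolynomial.coeff_C_mul, ← pow_mul_jetTerm p r hm', ← map_natCast MvPolynomial.C,
      ← map_pow, MvPolynomial.coeff_C_mul, map_mul, map_pow, map_natCast]
  have hfin' : (fun α => (p : ℚ)⁻¹ • (MvPowerSeries.coeff α (MvPowerSeries.map Φ f) •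
      MvPowerSeries.coeff β (α.prod fun i n => a i ^ n))).HasFiniteSupport :=
    hfin.smul_right fun _ => (p : ℚ)⁻¹
  simp only [← hterm]
  refine ⟨hfin', ?_⟩
  rw [← smul_finsum, ← MvPowerSeries.coeff_subst hs]
  rfl

theorem hasExpansion_of_finsum {p g r : ℕ} {ι B : Type*} [CommRing B] {x : JetRing p r g B}
    {f : MvPowerSeries (Fin r × Fin g) (ℚ ⊗[ℤ] B)}
    {t : ι → MvPolynomial (Fin r × Fin g) B}
    (ht : ∀ n, {i | ¬ (p : MvPolynomial (Fin r × Fin g) B) ^ n ∣ t i}.Finite)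
    (hx : ∀ (n : ℕ) (s : Finset ι), (∀ i ∉ s, (p : JetRing p r g B) ^ n ∣ toJetRing p r g B (t i)) →
      (p : JetRing p r g B) ^ n ∣ x - ∑ i ∈ s, toJetRing p r g B (t i))
    (hf : ∀ β, (fun i => (1 : ℚ) ⊗ₜ[ℤ] MvPolynomial.coeff β (t i)).HasFiniteSupport ∧
      MvPowerSeries.coeff β f = ∑ᶠ i, (1 : ℚ) ⊗ₜ[ℤ] MvPolynomial.coeff β (t i)) :
    HasExpansion x f := by
  classical
  intro n
  have hmem (i : ι) (hi : i ∉ (ht n).toFinset) :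
      (p : MvPolynomial (Fin r × Fin g) B) ^ n ∣ t i := by simpa using hi
  refine ⟨∑ i ∈ (ht n).toFinset, t i, ?_, fun β => ?_⟩
  · rw [evalₐ_eq_mk_iff, map_sum]
    refine hx n _ fun i hi => ?_
    have := map_dvd (toJetRing p r g B) (hmem i hi)
    rwa [map_pow, map_natCast] at this
  · obtain ⟨hfin, hfβ⟩ := hf β
    -- The support at `β` and the terms not divisible by `p^n` are unrelated finite sets. Over their
    -- union the sum computes the coefficient, and the added terms vanish modulo `p^n`.
    rw [hfβ, finsum_eq_sum_of_support_subset _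
      (s := (ht n).toFinset ∪ Set.Finite.toFinset hfin) (fun i hi => by
        rw [Finset.coe_union]; exact Or.inr ((Set.Finite.mem_toFinset hfin).2 hi)),
      ← TensorProduct.tmul_sum]
    obtain ⟨z, hz⟩ : (p : MvPolynomial (Fin r × Fin g) B) ^ n ∣
        ∑ i ∈ (ht n).toFinset ∪ Set.Finite.toFinset hfin, t i - ∑ i ∈ (ht n).toFinset, t i := by
      rw [← Finset.sum_sdiff (Finset.subset_union_left (s₂ := Set.Finite.toFinset hfin)),
        add_sub_cancel_right]
      exact Finset.dvd_sum fun i hi => hmem i (Finset.mem_sdiff.1 hi).2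
    refine ⟨MvPolynomial.coeff β z, ?_⟩
    have hc : MvPolynomial.coeff β ((p : MvPolynomial (Fin r × Fin g) B) ^ n * z) =
        (p : B) ^ n * MvPolynomial.coeff β z := by
      rw [← map_natCast MvPolynomial.C, ← map_pow, MvPolynomial.coeff_C_mul]
    rw [← MvPolynomial.coeff_sum, sub_eq_iff_eq_add'.1 hz, MvPolynomial.coeff_add, hc]

end Logarithm

/-! ### The natural map on coefficients and on `φ^r(T)|_{T=0}`. -/

section Natural

variable {p : ℕ} {O : Type} [CommRing O] {F : FrobeniusBase p O}
  {O' : Type} [CommRing O'] [Algebra O O'] {F' : FrobeniusBase p O'}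
  {S : ProlSeq.{u} F} {r g : ℕ}

variable (O' S r g) in
noncomputable def evalAtZero :
    MvPolynomial (ℕ × Fin g) O' →ₐ[O'] O' ⊗[O] JetRing p r g (S.obj r) :=
  MvPolynomial.aeval (fun jk => 1 ⊗ₜ[O] toJetRing p r g (S.obj r) (atZero r g _ jk))

theorem evalAtZero_map (z : MvPolynomial (ℕ × Fin g) ℤ) :
    evalAtZero O' S r g (MvPolynomial.map (Int.castRingHom O') z) =
      1 ⊗ₜ[O] toJetRing p r g (S.obj r) (MvPolynomial.aeval (atZero r g _) z) := by
  let ρ : MvPolynomial (Fin r × Fin g) (S.obj r) →+* O' ⊗[O] JetRing p r g (S.obj r) :=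
    (Algebra.TensorProduct.includeRight :
      JetRing p r g (S.obj r) →ₐ[O] O' ⊗[O] JetRing p r g (S.obj r)).toRingHom.comp
        (toJetRing p r g (S.obj r))
  change _ = ρ (MvPolynomial.aeval (atZero r g _) z)
  induction z using MvPolynomial.induction_on with
  | C a => simp
  | add a b ha hb => simp only [map_add, ha, hb]
  | mul_X a n ha =>
    simp only [map_mul, ha, MvPolynomial.map_X, MvPolynomial.aeval_X]
    rw [evalAtZero, MvPolynomial.aeval_X]
    rfl

variable [Fact p.Prime]

theorem ProlSeq.Hom.map_phi {S S' : ProlSeq.{u} F} (v : S.Hom S') (r : ℕ) (x : S.obj r) :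
    v.map (r + 1) (S.phi r x) = S'.phi r (v.map r x) := by
  change v.map (r + 1) (S.incl r x ^ p + algebraMap O _ F.ϖ * S.δ r x) =
    S'.incl r (v.map r x) ^ p + algebraMap O _ F.ϖ * S'.δ r (v.map r x)
  rw [map_add, map_pow, map_mul, AlgHom.commutes, v.map_incl, v.map_δ]

theorem ProlSeq.baseChange_phi (S : ProlSeq.{u} F) (h : F.Extends F')
    (hS : ∀ r, Module.Flat O (S.obj r)) (r : ℕ) (z : O' ⊗[O] S.obj r) :
    (S.baseChange h hS).phi r z = S.baseChangePhi h r z := by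
  change S.baseChangeIncl O' r z ^ p + algebraMap O' (O' ⊗[O] S.obj (r + 1)) F'.ϖ *
    (S.baseChange_dvd h r z).choose = _
  rw [← (S.baseChange_dvd h r z).choose_spec]
  ring

/-- Morphisms commute with `φ`, and `φ ⊗ φ` fixes the factor `1`. Thus a lift of `b` yields a lift
of `φ^r(b)`. -/
theorem ProlSeq.Hom.map_phiIter {S : ProlSeq.{u} F} {h : F.Extends F'}
    {hS : ∀ r, Module.Flat O (S.obj r)} {Sπ : ProlSeq.{u} F'} (v : Sπ.Hom (S.baseChange h hS))
    {x : Sπ.obj 0} {b : S.obj 0} (hx : v.map 0 x = (1 : O') ⊗ₜ[O] b) (r : ℕ) :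
    v.map r (Sπ.phiIter r x) = (1 : O') ⊗ₜ[O] S.phiIter r b := by
  induction r with
  | zero => exact hx
  | succ r ih =>
    change v.map (r + 1) (Sπ.phi r (Sπ.phiIter r x)) = (1 : O') ⊗ₜ[O] S.phi r (S.phiIter r b)
    rw [v.map_phi, ih, S.baseChange_phi, S.baseChangePhi_tmul, map_one]

variable {h : F.Extends F'} {hS : ∀ r, Module.Flat O (S.obj r)} {Sπ : ProlSeq.{u} F'}

theorem exists_eq_evalAtZero (v : Sπ.Hom (S.baseChange h hS))
    {Ψ : JetRing p r g (Sπ.obj r) →+* O' ⊗[O] JetRing p r g (S.obj r)}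
    (h1 : ∀ b, Ψ (toJetRing p r g _ (MvPolynomial.C b)) =
      Algebra.TensorProduct.map (AlgHom.id O' O')
        (IsScalarTower.toAlgHom O (S.obj r) (JetRing p r g (S.obj r))) (v.map r b))
    (h2 : ∀ (i : Fin r) (k : Fin g), Ψ (toJetRing p r g _ (MvPolynomial.X (i, k))) =
      evalAtZero O' S r g (deltaPoly g F' (i + 1) k))
    {z : MvPolynomial (ℕ × Fin g) O'} (hz : z ∈ deltaSubalgebra g F' r) :
    ∃ Q, Ψ (toJetRing p r g _ Q) = evalAtZero O' S r g z := by
  induction hz using Algebra.adjoin_induction with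
  | mem z hz =>
    obtain ⟨j, hj, k, rfl⟩ := hz
    rcases j with _ | j
    -- The variable `T` itself goes to zero; only `δ_π^j T` with `j ≥ 1` are variables of the
    -- source.
    · refine ⟨0, ?_⟩
      rw [deltaPoly, evalAtZero, MvPolynomial.aeval_X]
      simp [atZero]
    · exact ⟨MvPolynomial.X (⟨j, hj⟩, k), h2 _ _⟩
  | algebraMap a =>
    refine ⟨MvPolynomial.C (algebraMap O' _ a), ?_⟩
    rw [h1, AlgHom.commutes, AlgHom.commutes]
    exact AlgHom.commutes _ _
  | add x y _ _ hx hy =>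
    obtain ⟨Q, hQ⟩ := hx
    obtain ⟨Q', hQ'⟩ := hy
    exact ⟨Q + Q', by rw [map_add, map_add, map_add, hQ, hQ']⟩
  | mul x y _ _ hx hy =>
    obtain ⟨Q, hQ⟩ := hx
    obtain ⟨Q', hQ'⟩ := hy
    exact ⟨Q * Q', by rw [map_mul, map_mul, map_mul, hQ, hQ']⟩

/-- Two evaluations of `φ^r(T_i)` at `T = 0`: dividing by `p` gives `P_i`, dividing by `ϖ` gives an
element of the image of `Ψ`. -/
theorem exists_jetPoly_eq (v : Sπ.Hom (S.baseChange h hS))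
    {Ψ : JetRing p r g (Sπ.obj r) →+* O' ⊗[O] JetRing p r g (S.obj r)}
    (h1 : ∀ b, Ψ (toJetRing p r g _ (MvPolynomial.C b)) =
      Algebra.TensorProduct.map (AlgHom.id O' O')
        (IsScalarTower.toAlgHom O (S.obj r) (JetRing p r g (S.obj r))) (v.map r b))
    (h2 : ∀ (i : Fin r) (k : Fin g), Ψ (toJetRing p r g _ (MvPolynomial.X (i, k))) =
      evalAtZero O' S r g (deltaPoly g F' (i + 1) k)) (i : Fin g) :
    ∃ Q, algebraMap O' _ F'.ϖ * Ψ (toJetRing p r g _ Q) = 1 ⊗ₜ[O] toJetRing p r g (S.obj r)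
      ((p : MvPolynomial (Fin r × Fin g) (S.obj r)) * jetPoly p r (S.obj r) i) := by
  have hp0 : p ≠ 0 := (Fact.out : p.Prime).ne_zero
  obtain ⟨q, hq, e⟩ := exists_iterate_phiPoly_eq_deltaPoly F' r i
  obtain ⟨Q, hQ⟩ := exists_eq_evalAtZero v h1 h2 hq
  refine ⟨Q, ?_⟩
  have h0 : evalAtZero O' S r g (MvPolynomial.X (0, i)) = 0 := by
    rw [evalAtZero, MvPolynomial.aeval_X]
    simp [atZero]
  have h3 := congrArg (evalAtZero O' S r g) e
  rw [← map_iterate_phiPoly, evalAtZero_map, aeval_atZero_iterate_phiPoly hp0, map_add, map_pow,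
    h0, zero_pow (pow_ne_zero _ hp0), zero_add,
    map_mul (evalAtZero O' S r g), ← hQ, ← MvPolynomial.algebraMap_eq,
    AlgHom.commutes] at h3
  exact h3.symm

end Natural

end PiJet

namespace PiJet

theorem eq_zero_of_natCast_mul_jetRing {p r g : ℕ} {B : Type*} [CommRing B]
    (hB : ∀ q : B, (p : B) * q = 0 → q = 0) (x : JetRing p r g B)
    (hx : (p : JetRing p r g B) * x = 0) : x = 0 := by
  refine eq_zero_of_natCast_mul_adicCompletion (fun q hq => ?_) hx
  ext β
  refine hB _ ?_
  rw [← MvPolynomial.coeff_C_mul, map_natCast, hq, MvPolynomial.coeff_zero]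

theorem eq_of_pow_natCast_mul {p : ℕ} {B : Type*} [CommRing B]
    (hB : ∀ q : B, (p : B) * q = 0 → q = 0) (n : ℕ) {x y : B}
    (hxy : (p : B) ^ n * x = (p : B) ^ n * y) : x = y := by
  induction n with
  | zero => simpa using hxy
  | succ n ih =>
    refine ih ?_
    rw [← sub_eq_zero]
    refine hB _ ?_
    linear_combination hxy

/-! ### Existence and uniqueness of the natural map, and a criterion for its image. -/

section Natural

variable {p : ℕ} [Fact p.Prime] {O : Type} [CommRing O] {F : FrobeniusBase p O}
  {O' : Type} [CommRing O'] [Algebra O O'] {F' : FrobeniusBase p O'}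
  {S : ProlSeq.{u} F} {r g : ℕ} {h : F.Extends F'}

/-- On `O' ⊗ A` the map is `id ⊗ ι`, which already reaches everything modulo `p`; completeness does
the rest. -/
theorem ProlSeq.Hom.map_zero_surjective [Module.Free O O'] [Module.Finite O O']
    {A : Type u} [CommRing A] [Algebra O A] {ι : A →ₐ[O] S.obj 0} (hS : S.IsJet ι)
    {Sπ : ProlSeq.{u} F'} {ιπ : O' ⊗[O] A →ₐ[O'] Sπ.obj 0} (hSπ : Sπ.InProl)
    (v : Sπ.Hom (S.baseChange h hS.inProl.flat))
    (hv : ∀ x, v.map 0 (ιπ x) = Algebra.TensorProduct.map (AlgHom.id O' O') ι x)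
    (z : O' ⊗[O] S.obj 0) : ∃ x, v.map 0 x = z := by
  have hA : IsPComplete p (Sπ.obj 0) := (isPComplete_iff _).2 (hSπ.complete 0)
  have hC : IsPComplete p (O' ⊗[O] S.obj 0) :=
    ((isPComplete_iff (S.obj 0)).2 (hS.inProl.complete 0)).tensor
  let f : Sπ.obj 0 →+* O' ⊗[O] S.obj 0 := (v.map 0).toRingHom
  have hf (x) : f (ιπ x) = Algebra.TensorProduct.map (AlgHom.id O' O') ι x := hv x
  refine hA.surjective_of_mod hC f (fun c => ?_) z
  induction c with
  | zero => exact ⟨0, by simp⟩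
  | add c c' hc hc' =>
    obtain ⟨a, ha⟩ := hc
    obtain ⟨a', ha'⟩ := hc'
    exact ⟨a + a', by rw [map_add, add_sub_add_comm]; exact dvd_add ha ha'⟩
  | tmul y s =>
    obtain ⟨a, d, hd⟩ := hS.completion_surjective 1 s
    refine ⟨ιπ (y ⊗ₜ a), y ⊗ₜ d, ?_⟩
    rw [hf, Algebra.TensorProduct.map_tmul, AlgHom.id_apply, ← TensorProduct.tmul_sub, hd, pow_one,
      ← nsmul_eq_mul, ← nsmul_eq_mul, TensorProduct.tmul_smul]

/-- A natural homomorphism exists and is unique. -/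
theorem existsUnique_isNaturalMap [Module.Free O O'] [Module.Finite O O']
    {A : Type u} [CommRing A] [Algebra O A] {ι : A →ₐ[O] S.obj 0} (hS : S.IsJet ι)
    {Sπ : ProlSeq.{u} F'} {ιπ : O' ⊗[O] A →ₐ[O'] Sπ.obj 0} (hSπ : Sπ.IsJet ιπ) :
    ∃! Ψ : JetRing p r g (Sπ.obj r) →+* O' ⊗[O] JetRing p r g (S.obj r),
      IsNaturalMap S ι h hS.inProl.flat Sπ ιπ r g Ψ := by
  let ιS : O' ⊗[O] A →ₐ[O'] (S.baseChange h hS.inProl.flat).obj 0 :=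
    (Algebra.TensorProduct.map (AlgHom.id O' O') ι : O' ⊗[O] A →ₐ[O'] O' ⊗[O] S.obj 0)
  obtain ⟨v, hv, hv'⟩ := hSπ.universal _ (hS.inProl.baseChange h) ιS
  have hC : IsPComplete p (O' ⊗[O] JetRing p r g (S.obj r)) :=
    (isPComplete_adicCompletion (p := p)
      (P := MvPolynomial (Fin r × Fin g) (S.obj r))).tensor (O := O) (O' := O')
  let τ : O' ⊗[O] S.obj r →+* O' ⊗[O] JetRing p r g (S.obj r) :=
    (Algebra.TensorProduct.map (AlgHom.id O' O')
      (IsScalarTower.toAlgHom O (S.obj r) (JetRing p r g (S.obj r)))).toRingHom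
  let vr : Sπ.obj r →+* O' ⊗[O] S.obj r := (v.map r).toRingHom
  let f : MvPolynomial (Fin r × Fin g) (Sπ.obj r) →+* O' ⊗[O] JetRing p r g (S.obj r) :=
    MvPolynomial.eval₂Hom (τ.comp vr) fun ik =>
      evalAtZero O' S r g (deltaPoly g F' (ik.1 + 1) ik.2)
  have hfC (b : Sπ.obj r) : f (MvPolynomial.C b) = τ (vr b) := MvPolynomial.eval₂_C _ _ _
  have hfX (i : Fin r) (k : Fin g) : f (MvPolynomial.X (i, k)) =
    evalAtZero O' S r g (deltaPoly g F' (i + 1) k) := MvPolynomial.eval₂_X _ _ _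
  obtain ⟨Ψ, hΨ⟩ := exists_ringHom_adicCompletion hC f
  refine ⟨Ψ, ⟨v, hv, fun b => ?_, fun i k => ?_⟩, ?_⟩
  · exact (hΨ _).trans (hfC b)
  · exact (hΨ _).trans (hfX i k)
  · rintro Ψ' ⟨v', hv0, h1, h2⟩
    -- Universality leaves one choice of `v`, and then `Ψ` is fixed on constants and variables.
    obtain rfl := hv' v' hv0
    have hcomp : Ψ'.comp (toJetRing p r g (Sπ.obj r)) = f := by
      refine MvPolynomial.ringHom_ext (fun b => ?_) fun ⟨i, k⟩ => ?_
      · rw [hfC]; exact h1 b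
      · rw [hfX]; exact h2 i k
    exact ringHom_eq_of_comp_algebraMap_eq hC fun q =>
      (RingHom.congr_fun hcomp q).trans (hΨ q).symm

/-- A series whose terms are, up to the factor `p ^ (N + 1)`, images under `Ψ` of terms tending
to zero has its `p ^ (N + 1)`-multiple in the image of `Ψ`. -/
theorem mem_range_of_terms [Module.Free O O'] [Module.Finite O O']
    (hS : ∀ r, Module.Flat O (S.obj r)) (htf : ∀ q : S.obj r, (p : S.obj r) * q = 0 → q = 0)
    {Sπ : ProlSeq.{u} F'} (v : Sπ.Hom (S.baseChange h hS))
    {Ψ : JetRing p r g (Sπ.obj r) →+* O' ⊗[O] JetRing p r g (S.obj r)}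
    (h1 : ∀ b, Ψ (toJetRing p r g _ (MvPolynomial.C b)) =
      Algebra.TensorProduct.map (AlgHom.id O' O')
        (IsScalarTower.toAlgHom O (S.obj r) (JetRing p r g (S.obj r))) (v.map r b))
    (h2 : ∀ (i : Fin r) (k : Fin g), Ψ (toJetRing p r g _ (MvPolynomial.X (i, k))) =
      evalAtZero O' S r g (deltaPoly g F' (i + 1) k))
    {m : (Fin g →₀ ℕ) → ℕ} {b : (Fin g →₀ ℕ) → S.obj 0} {b' : (Fin g →₀ ℕ) → Sπ.obj 0}
    {d : (Fin g →₀ ℕ) → O'} {N : ℕ}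
    (hm : ∀ α, m α + 1 ≤ α.degree ∨ b α = 0)
    (hb : ∀ α, v.map 0 (b' α) = (1 : O') ⊗ₜ[O] b α)
    (hd : ∀ α, (p : O') ^ m α * d α = (p : O') ^ N * F'.ϖ ^ α.degree)
    (hdf : ∀ n, {α | ¬ (p : O') ^ n ∣ d α}.Finite)
    (htfin : ∀ n, {α | ¬ (p : JetRing p r g (S.obj r)) ^ n ∣
      toJetRing p r g _ (jetTerm p r (m α) (S.phiIter r (b α)) α)}.Finite)
    {x : JetRing p r g (S.obj r)}
    (hx : ∀ (n : ℕ) (s : Finset (Fin g →₀ ℕ)),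
      (∀ α ∉ s, (p : JetRing p r g (S.obj r)) ^ n ∣
        toJetRing p r g _ (jetTerm p r (m α) (S.phiIter r (b α)) α)) →
      (p : JetRing p r g (S.obj r)) ^ n ∣
        x - ∑ α ∈ s, toJetRing p r g _ (jetTerm p r (m α) (S.phiIter r (b α)) α)) :
    (1 : O') ⊗ₜ[O] ((p : JetRing p r g (S.obj r)) ^ (N + 1) * x) ∈ Ψ.range := by
  classical
  choose Q hQ using exists_jetPoly_eq v h1 h2
  let J := JetRing p r g (S.obj r)
  let C := O' ⊗[O] J
  let κ : J →+* C := (Algebra.TensorProduct.includeRight : J →ₐ[O] O' ⊗[O] J).toRingHom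
  let ρ : MvPolynomial (Fin r × Fin g) (S.obj r) →+* C := κ.comp (toJetRing p r g (S.obj r))
  let ψ : MvPolynomial (Fin r × Fin g) (Sπ.obj r) →+* C := Ψ.comp (toJetRing p r g (Sπ.obj r))
  have hC : IsPComplete p C :=
    (isPComplete_adicCompletion (p := p)
      (P := MvPolynomial (Fin r × Fin g) (S.obj r))).tensor (O := O) (O' := O')
  have hCtf : ∀ z : C, (p : C) * z = 0 → z = 0 :=
    eq_zero_of_natCast_mul_tensor (eq_zero_of_natCast_mul_jetRing htf)
  let t (α : Fin g →₀ ℕ) := jetTerm p r (m α) (S.phiIter r (b α)) α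
  -- Since `p P_i = ϖ Ψ(Q_i)`, this lifts `p^(N+1)` times the `α`-term; `d α` plays the role of `p^N
  -- ϖ^|α| / p^m`.
  let w (α : Fin g →₀ ℕ) : MvPolynomial (Fin r × Fin g) (Sπ.obj r) :=
    MvPolynomial.C (algebraMap O' _ (d α) * Sπ.phiIter r (b' α)) * α.prod fun i n => Q i ^ n
  have hψC (c : O') (x : Sπ.obj 0) (y : S.obj 0) (hxy : v.map 0 x = (1 : O') ⊗ₜ[O] y) :
      ψ (MvPolynomial.C (algebraMap O' _ c * Sπ.phiIter r x)) =
        algebraMap O' C c * ρ (MvPolynomial.C (S.phiIter r y)) := by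
    refine (h1 _).trans ?_
    rw [map_mul, AlgHom.commutes, v.map_phiIter hxy]
    refine (map_mul _ _ _).trans ?_
    rw [Algebra.TensorProduct.map_tmul]
    congr 1
  have hterm (α : Fin g →₀ ℕ) : ψ (w α) = κ ((p : J) ^ (N + 1) * toJetRing p r g _ (t α)) := by
    -- The target has no `p`-torsion, so the identity may be checked after clearing `p^m`.
    refine eq_of_pow_natCast_mul hCtf (m α) ?_
    have hm' : m α + 1 ≤ α.degree ∨ S.phiIter r (b α) = 0 :=
      (hm α).imp_right fun h => by rw [h, map_zero]
    have e1 : (p : C) ^ m α * algebraMap O' C (d α) = (p : C) ^ N * algebraMap O' C F'.ϖ ^ α.degree := by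
      have := congrArg (algebraMap O' C) (hd α)
      simpa only [map_mul, map_pow, map_natCast] using this
    have e2 : algebraMap O' C F'.ϖ ^ α.degree * ψ (α.prod fun i n => Q i ^ n) =
        ρ (α.prod fun i n => ((p : MvPolynomial (Fin r × Fin g) (S.obj r)) *
          jetPoly p r (S.obj r) i) ^ n) := by
      rw [map_finsuppProd, map_finsuppProd]
      simp only [map_pow]
      rw [← finsupp_prod_mul_pow]
      refine Finsupp.prod_congr fun i _ => ?_
      exact congrArg (· ^ α i) (hQ i)
    have e3 : (p : C) ^ m α * κ ((p : J) ^ (N + 1) * toJetRing p r g _ (t α)) =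
        (p : C) ^ N * ρ ((p : MvPolynomial (Fin r × Fin g) (S.obj r)) ^ (m α + 1) * t α) := by
      have : κ (toJetRing p r g _ (t α)) = ρ (t α) := rfl
      rw [map_mul, map_mul, map_pow, map_pow, map_natCast, map_natCast, this]
      ring
    have e4 : ψ (w α) = algebraMap O' C (d α) * ρ (MvPolynomial.C (S.phiIter r (b α))) *
        ψ (α.prod fun i n => Q i ^ n) :=
      (map_mul ψ _ _).trans (by rw [hψC _ _ _ (hb α)])
    rw [e3, e4, pow_mul_jetTerm p r hm', map_mul ρ, ← e2]
    linear_combination (ρ (MvPolynomial.C (S.phiIter r (b α))) *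
      ψ (α.prod fun i n => Q i ^ n)) * e1
  have hwfin (n : ℕ) : {α | ¬ (p : JetRing p r g (Sπ.obj r)) ^ n ∣
      toJetRing p r g _ (w α)}.Finite := by
    refine (hdf n).subset fun α hα hdvd => hα ?_
    obtain ⟨c, hc⟩ := hdvd
    refine ⟨toJetRing p r g _ (MvPolynomial.C (algebraMap O' _ c * Sπ.phiIter r (b' α)) *
      α.prod fun i n => Q i ^ n), ?_⟩
    have e : w α = (p : MvPolynomial (Fin r × Fin g) (Sπ.obj r)) ^ n *
        (MvPolynomial.C (algebraMap O' _ c * Sπ.phiIter r (b' α)) *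
          α.prod fun i n => Q i ^ n) := by
      simp only [w]
      rw [hc]
      simp only [map_mul, map_pow, map_natCast]
      ring
    rw [e, map_mul, map_pow, map_natCast]
  obtain ⟨W, hW⟩ := (isPComplete_adicCompletion (p := p)
      (P := MvPolynomial (Fin r × Fin g) (Sπ.obj r))).exists_sum
      (fun α => toJetRing p r g _ (w α)) hwfin
  refine ⟨W, ?_⟩
  change Ψ W = κ ((p : J) ^ (N + 1) * x)
  refine hC.eq_of_forall_dvd fun n => ?_
  -- A common index set large enough for both sums modulo `p^n`.
  let s := (hwfin n).toFinset ∪ (htfin n).toFinset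
  have hs1 := map_dvd Ψ (hW n s fun α hα => by
    have : α ∉ (hwfin n).toFinset := fun h => hα (Finset.mem_union_left _ h)
    simpa using this)
  have hs2 := map_dvd κ ((hx n s fun α hα => by
    have : α ∉ (htfin n).toFinset := fun h => hα (Finset.mem_union_right _ h)
    simpa using this).mul_left ((p : J) ^ (N + 1)))
  rw [map_pow, map_natCast, map_sub, map_sum] at hs1
  rw [map_pow, map_natCast, mul_sub, map_sub, Finset.mul_sum, map_sum] at hs2
  have hsum : ∑ α ∈ s, Ψ (toJetRing p r g _ (w α)) =
      ∑ α ∈ s, κ ((p : J) ^ (N + 1) * toJetRing p r g _ (t α)) :=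
    Finset.sum_congr rfl fun α _ => hterm α
  rw [hsum] at hs1
  have := dvd_sub hs1 hs2
  rwa [sub_sub_sub_cancel_right] at this

end Natural

theorem natCast_mul_eq_zero_of_flat {p : ℕ} [Fact p.Prime] {B : Type*} [CommRing B]
    [Algebra (R p) B] [Module.Flat (R p) B] (q : B) (hq : (p : B) * q = 0) : q = 0 := by
  have hp : (p : R p) ∈ nonZeroDivisors (R p) :=
    mem_nonZeroDivisors_of_ne_zero
      (WittVector.irreducible (k := AlgebraicClosure (ZMod p)) p).ne_zero
  refine Module.Flat.isSMulRegular_of_nonZeroDivisors (M := B) hp ?_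
  simp only [Algebra.smul_def, map_natCast, hq, mul_zero]

theorem finite_of_forall_le_degree {g : ℕ} {q : (Fin g →₀ ℕ) → Prop} (n : ℕ)
    (h : ∀ α : Fin g →₀ ℕ, n ≤ α.degree → q α) : {α | ¬ q α}.Finite :=
  (Finsupp.finite_of_degree_lt n).subset fun α hα => by
    by_contra h'
    exact hα (h α (not_lt.1 h'))

end PiJet

/-! ### The main theorem. -/

open PiJet

theorem proposition4p5 {p : ℕ} [Fact p.Prime] (hp : 5 ≤ p)
    {φ : Kalg p ≃+* Kalg p} (hφ : ExtendsFrobenius φ) {π : Kalg p} (hπ : IsPi π)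
    {A : Type u} [CommRing A] [Algebra (R p) A] [Algebra.Smooth (R p) A]
    (S : ProlSeq.{u} (baseR p)) (ι : A →ₐ[R p] S.obj 0) (hS : S.IsJet ι)
    (Sπ : ProlSeq.{u} (baseRpi hφ hπ)) (ιπ : Rpi π ⊗[R p] A →ₐ[Rpi π] Sπ.obj 0)
    (hSπ : Sπ.IsJet ιπ)
    {g : ℕ} (𝓕 : FormalGroupLaw g (S.obj 0))
    (l : Fin g → MvPowerSeries (Fin g) (ℚ ⊗[ℤ] S.obj 0)) (hl : 𝓕.IsLogarithm l) (r : ℕ) :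
    (∃! Ψ : JetRing p r g (Sπ.obj r) →+* Rpi π ⊗[R p] JetRing p r g (S.obj r),
      IsNaturalMap S ι (baseR_extends hφ hπ) hS.inProl.flat Sπ ιπ r g Ψ) ∧
    ∃ L : Fin g → JetRing p r g (S.obj r),
      (∀ k, HasExpansion (L k) (jetLog S l r k)) ∧
      ∀ Ψ : JetRing p r g (Sπ.obj r) →+* Rpi π ⊗[R p] JetRing p r g (S.obj r),
        IsNaturalMap S ι (baseR_extends hφ hπ) hS.inProl.flat Sπ ιπ r g Ψ →
        ∀ k, (1 : Rpi π) ⊗ₜ[R p] ((p : JetRing p r g (S.obj r)) ^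
          (⌊Real.log (ramIndex π) / Real.log p⌋₊ + 2) * L k) ∈ Ψ.range := by
  have hfree := free_Rpi hπ
  have hfinite := finite_Rpi hπ
  have hp2 : 2 ≤ p := by omega
  refine ⟨existsUnique_isNaturalMap hS hSπ, ?_⟩
  have hS0 : IsPComplete p (S.obj 0) := (isPComplete_iff _).2 (hS.inProl.complete 0)
  choose m b hb hmb using fun k => hl.exists_pow_mul_coeff hS0 k
  -- From `m < p^m ≤ |α|`.
  have hm (k : Fin g) (α : Fin g →₀ ℕ) : m k α + 1 ≤ α.degree ∨ b k α = 0 :=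
    (hmb k α).imp (fun h => (Nat.lt_pow_self (by omega)).trans_le h) And.right
  have hpow (k : Fin g) (α : Fin g →₀ ℕ) (hα : 1 ≤ α.degree) : p ^ m k α ≤ α.degree := by
    rcases hmb k α with h | ⟨h, -⟩
    · exact h
    · rwa [h, pow_zero]
  have htfin (k : Fin g) (n : ℕ) : {α | ¬ (p : MvPolynomial (Fin r × Fin g) (S.obj r)) ^ n ∣
      jetTerm p r (m k α) (S.phiIter r (b k α)) α}.Finite := by
    -- The exponent is `|α| - 1 - m`, hence `n + 1`; the maximum with `1` below excludes `α = 0`,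
    -- where `p^m ≤ |α|` fails.
    obtain ⟨c, hc⟩ := exists_forall_add_le_div hp2 one_pos (n + 1)
    refine finite_of_forall_le_degree (max c 1) fun α hα => ?_
    have := hc _ (le_of_max_le_left hα) _ (hpow k α (le_of_max_le_right hα))
    rw [Nat.div_one] at this
    refine Dvd.dvd.mul_right ?_ _
    rw [map_mul, map_pow, map_natCast]
    exact (pow_dvd_pow _ (by omega)).mul_right _
  have htfin' (k : Fin g) (n : ℕ) : {α | ¬ (p : JetRing p r g (S.obj r)) ^ n ∣
      toJetRing p r g _ (jetTerm p r (m k α) (S.phiIter r (b k α)) α)}.Finite :=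
    (htfin k n).subset fun α hα hdvd => hα (by
      have := map_dvd (toJetRing p r g (S.obj r)) hdvd
      rwa [map_pow, map_natCast] at this)
  choose L hL using fun k => (isPComplete_adicCompletion (p := p)
    (P := MvPolynomial (Fin r × Fin g) (S.obj r))).exists_sum _ (htfin' k)
  refine ⟨L, fun k => hasExpansion_of_finsum (htfin k) (hL k) fun β =>
    coeff_subst_jetPoly (S.phiIter r) (l k) r (hb k) (hm k) β, ?_⟩
  rintro Ψ ⟨v, hv, h1, h2⟩ k
  have := hS.inProl.flat r
  choose b' hb' using fun α =>
    v.map_zero_surjective hS hSπ.inProl hv ((1 : Rpi π) ⊗ₜ[R p] b k α)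
  have he := ramIndex_pos hπ
  choose w hw using exists_pi_pow_eq hπ
  set s := ⌊Real.log (ramIndex π) / Real.log p⌋₊
  have hle (α : Fin g →₀ ℕ) : m k α ≤ s + 1 + α.degree / ramIndex π := by
    rcases hmb k α with h | ⟨h, -⟩
    · exact le_add_div_of_pow_le hp2 (lt_pow_floor_log hp2 he) he h
    · rw [h]; exact Nat.zero_le _
  -- Here `π^n = p^(n/e) w n`, so `d α` is `p^(s+1) π^|α| / p^m`, integral by `hle`. Taking `N = s +
  -- 1` gives the exponent `N + 1 = s + 2`.
  refine mem_range_of_terms hS.inProl.flat natCast_mul_eq_zero_of_flat v h1 h2 (m := m k)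
    (b := b k) (b' := b')
    (d := fun α => (p : Rpi π) ^ (s + 1 + α.degree / ramIndex π - m k α) * w α.degree)
    (N := s + 1) (hm k) hb' (fun α => ?_) (fun n => ?_) (htfin' k) (hL k)
  · change _ = (p : Rpi π) ^ (s + 1) * piElt π ^ α.degree
    rw [hw, ← mul_assoc, ← pow_add, Nat.add_sub_cancel' (hle α), pow_add, mul_assoc]
  · obtain ⟨c, hc⟩ := exists_forall_add_le_div hp2 he n
    refine finite_of_forall_le_degree (max c 1) fun α hα => ?_
    have := hc _ (le_of_max_le_left hα) _ (hpow k α (le_of_max_le_right hα))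
    refine Dvd.dvd.mul_right (pow_dvd_pow _ (Nat.le_sub_of_add_le ?_)) _
    exact this.trans (Nat.le_add_left _ _)
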